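/- Let $V$ be a finite set with $n=|V|$ elements and let $A\in(\mathbb{Z}_{\ge 0})^{V\times V}$ be the (possibly weighted) adjacency matrix of a graph on $V$. For $u,v\in V$ put $d_u=\sum_{w\in V}A_{uw}$ and $n_{uv}=\sum_{w\in V}A_{uw}A_{vw}$, and assume $d_u>0$ for every $u\in V$. Let $T\in\mathbb{R}^{V\times V}$ be the transition matrix, $T_{uw}=A_{uw}/d_u$. For each $q\in\mathbb{N}$ let $R=R^{(q)}$ be a random $q\times n$ matrix, with columns indexed by $V$, whose entries are i.i.d. normal random variables with mean $0$ and variance $1/q$. Let $X=X^{(q)}=TR^\top$, and let $X_u\in\mathbb{R}^q$ denote the row of $X$ that belongs to the vertex $u$. Then the following hold. (a) For all $u,v\in V$, the dot product $X_u\cdot X_v$ is asymptotically normal with mean $\mu=\frac{n_{uv}}{d_ud_v}$ and variance $\sigma^2/q$, where $$\sigma^2=\frac{n_{uu}n_{vv}}{d_u^2d_v^2}+\left(\frac{n_{uv}}{d_ud_v}\right)^2>0,$$ that is, $\frac{X_u\cdot X_v-\mu}{\sigma}\sqrt q$ converges in distribution to $\mathcal N(0,1)$ as $q\to\infty$. (b)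 Suppose $n\ge 2$. For all $\varepsilon\in(0,1)$ and $\delta\in(0,1)$ and every $q\in\mathbb{N}$ with $$q\ \ge\ 4\,\frac{1+\varepsilon}{\varepsilon^2}\,\log\left[\frac{n(n-1)}{\delta}\right],$$ with probability at least $1-\delta$ the inequality $$\left|X_u\cdot X_v-\frac{n_{uv}}{d_ud_v}\right|<\varepsilon\,\frac{\sqrt{n_{uu}n_{vv}}}{d_ud_v}$$ holds simultaneously for all $u,v\in V$. -/

import Mathlib

open MeasureTheory ProbabilityTheory Filter
open scoped NNReal ENNReal Matrix

/-- Degree `d_u` of the vertex `u`: the row sum of the (possibly weighted) adjacency matrix. -/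
def nodeDegree {V : Type*} [Fintype V] (A : Matrix V V ℕ) (u : V) : ℕ :=
  ∑ w, A u w

/-- 2-hop connectivity `n_{uv} = A_{u*} A_{v*}ᵀ`. -/
def twoHop {V : Type*} [Fintype V] (A : Matrix V V ℕ) (u v : V) : ℕ :=
  A u ⬝ᵥ A v

/-- Transition matrix `T`: the rows of the adjacency matrix, each divided by the degree. -/
noncomputable def transitionMatrix {V : Type*} [Fintype V] (A : Matrix V V ℕ) : Matrix V V ℝ :=
  Matrix.of fun u w => (A u w : ℝ) / (nodeDegree A u : ℝ)

/-- The embedding `X = T Rᵀ`; the vertex `u` is represented by the row `X u`. -/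
noncomputable def embedding {V : Type*} [Fintype V] {q : ℕ} (A : Matrix V V ℕ)
    (R : Matrix (Fin q) V ℝ) : Matrix V (Fin q) ℝ :=
  transitionMatrix A * Rᵀ

/-- `R` is a random `q × V` matrix whose entries are i.i.d. normal random variables with mean `0`
and variance `1 / q`. -/
structure IsGaussianProjection {V Ω : Type*} [MeasurableSpace Ω] {q : ℕ}
    (R : Ω → Matrix (Fin q) V ℝ) (P : Measure Ω) : Prop where
  hasLaw : ∀ i w, HasLaw (fun ω => R ω i w) (gaussianReal 0 ((q : ℝ≥0)⁻¹)) P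
  indep : iIndepFun (fun (p : Fin q × V) ω => R ω p.1 p.2) P

/-- `Y_q` is asymptotically `N(μ, v / q)`, where `v > 0`: the standardized variable
`(Y_q - μ) / √v * √q` converges in distribution to `N(0, 1)` as `q → ∞`. The `Y_q` may live on
different probability spaces. -/
def AsymptoticallyNormal {Ω : ℕ → Type*} [∀ q, MeasurableSpace (Ω q)]
    (P : ∀ q, Measure (Ω q)) [∀ q, IsProbabilityMeasure (P q)]
    (Y : ∀ q, Ω q → ℝ) (μ v : ℝ) : Prop :=
  0 < v ∧
    TendstoInDistribution (fun q ω => (Y q ω - μ) / √v * √(q : ℝ)) atTop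
      (id : ℝ → ℝ) P (gaussianReal 0 1)

/-! Let c, d be the rows of T at u, v. Then X_u·X_v = Σ_i (R_i·c)(R_i·d), a sum over the i.i.d. rows
of R.

(a) The rows √q R_i are standard Gaussian vectors whatever q is. So the standardized sum has
characteristic function φ(t/√q)^q with one fixed φ, and convergence of characteristic functions
gives the limit law (`asymptoticallyNormal_sum_row_mul_row`). The variance comes from fourth moments
by polarization.

(b) Put L = qε²/(4(1+ε)). The hypothesis on q says e^{-L} ≤ δ/(n(n-1)), while the diagonal raises
the number of unordered pairs to n(n+1)/2. A bound 2e^{-L} per pair is therefore too weak, but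
(2/3)e^{-L} suffices, since n(n+1)/3 ≤ n(n-1) for n ≥ 2. Each one-sided tail must thus gain a factor
3 over e^{-L}.

After normalizing to unit vectors a, b with ρ = a·b in [0,1], the sum is (|R(a+b)|² - |R(a-b)|²)/4,
and the two squares are independent because a+b ⊥ a-b. The first is a multiple of a gamma variable.
Bounding its density, not just its mgf, by an exponential and integrating over a half-line yields a
prefactor of order 1/(|l|√q), where l is the tilt; this is the source of the gain. The second square
enters through its mgf (`measure_le_add_le_of_indepFun`). The result is exp(`logTail`) with m = q -
2 (`unit_tail_le`).

This exponent is convex in ρ, so only ρ = 0 and ρ = 1 matter. For an explicit l of each sign, four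
endpoint inequalities remain (`exists_logTail_le`). They rest on L ≥ log 2, which holds because
n(n-1)/δ ≥ 2. -/

/-! ### Elementary logarithm estimates -/

theorem Real.log_le_half_sub_inv {x : ℝ} (hx : 1 ≤ x) : Real.log x ≤ (x - x⁻¹) / 2 := by
  rw [← Real.sinh_log (by linarith)]
  exact Real.self_le_sinh_iff.2 (Real.log_nonneg hx)

theorem Real.neg_log_one_sub_le {x : ℝ} (h0 : 0 ≤ x) (h1 : x < 1) :
    -Real.log (1 - x) ≤ x + x ^ 2 / (2 * (1 - x)) := by
  have h := Real.log_le_half_sub_inv (x := (1 - x)⁻¹) (by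
    rw [one_le_inv₀ (by linarith)]; linarith)
  rw [Real.log_inv, inv_inv] at h
  refine h.trans (le_of_eq ?_)
  have : (1 - x) ≠ 0 := by linarith
  field_simp
  ring

theorem Real.log_one_add_le_sub {x : ℝ} (h0 : 0 ≤ x) :
    Real.log (1 + x) ≤ x - x ^ 2 / (2 * (1 + x)) := by
  have h := Real.log_le_half_sub_inv (x := 1 + x) (by linarith)
  refine h.trans (le_of_eq ?_)
  have : (1 + x) ≠ 0 := by linarith
  field_simp
  ring

/-- Twice the left side is log(9/π), and 9/π is close enough to e for log x ≤ x - 1 at x = 2.865/e.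
The 3 is the factor to be gained; the π comes from Stirling. -/
theorem log_three_sub_half_log_pi_le : Real.log 3 - Real.log Real.pi / 2 ≤ 0.527 := by
  have h : Real.log (9 / Real.pi) ≤ 1.054 := by
    have hpi := Real.pi_gt_d4
    have he := Real.exp_one_gt_d9
    have h1 : 9 / Real.pi ≤ 2.865 := by
      rw [div_le_iff₀ (by positivity)]; linarith
    have h2 := Real.log_le_sub_one_of_pos (x := 2.865 / Real.exp 1) (by positivity)
    rw [Real.log_div (by norm_num) (by positivity), Real.log_exp] at h2
    have h3 : 2.865 / Real.exp 1 ≤ 1.054 := by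
      rw [div_le_iff₀ (by positivity)]; linarith
    linarith [Real.log_le_log (by positivity) h1]
  rw [Real.log_div (by norm_num) (by positivity), show (9:ℝ) = 3 ^ 2 by norm_num, Real.log_pow] at h
  push_cast at h
  linarith

/-- Tangent at y = 1/e. It is used for y = v/(ε+v) ≤ 0.3755, whose upper limit is near 1/e. -/
theorem Real.log_le_exp_one_mul_sub_two {y : ℝ} (hy : 0 < y) : Real.log y ≤ Real.exp 1 * y - 2 := by
  have h := Real.log_le_sub_one_of_pos (x := Real.exp 1 * y) (by positivity)
  rw [Real.log_mul (by positivity) hy.ne', Real.log_exp] at h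
  linarith

/-! ### The tail exponent and its endpoint values -/

/-- The logarithm of the tail bound for the normalized product, as a function of the correlation. -/
noncomputable def logTail (m ε l ρ : ℝ) : ℝ :=
  1 / 16 - Real.log (Real.pi * m) / 2 - Real.log |l| - Real.log (1 + ρ)
    - m / 2 * Real.log (1 - l * (1 + ρ)) - (m + 2) / 2 * Real.log (1 + l * (1 - ρ))
    - (m + 2) * (|l| * ε + l * ρ)

theorem convexOn_neg_log_comp_affine {a b : ℝ} {s : Set ℝ} (hs : Convex ℝ s)
    (h : ∀ x ∈ s, 0 < a + b * x) : ConvexOn ℝ s (fun x => -Real.log (a + b * x)) := by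
  refine ⟨hs, fun x hx y hy c d hc hd hcd => ?_⟩
  have := strictConcaveOn_log_Ioi.concaveOn.2 (h x hx) (h y hy) hc hd hcd
  simp only [smul_eq_mul] at this ⊢
  have e : a + b * (c * x + d * y) = c * (a + b * x) + d * (a + b * y) := by
    linear_combination (-a) * hcd
  rw [e]
  linarith

/-- In ρ the exponent is a sum of negated logarithms of affine functions and an affine term, hence
convex. The range of l keeps the affine functions positive on [0,1]. -/
theorem logTail_le_max {m ε l ρ : ℝ} (hm : 0 ≤ m) (hl : l < 1 / 2) (hl' : -1 < l)
    (h0 : 0 ≤ ρ) (h1 : ρ ≤ 1) :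
    logTail m ε l ρ ≤ max (logTail m ε l 0) (logTail m ε l 1) := by
  have hc : Convex ℝ (Set.Icc (0 : ℝ) 1) := convex_Icc 0 1
  have c1 : ConvexOn ℝ (Set.Icc (0 : ℝ) 1) (fun x => -Real.log (1 + 1 * x)) :=
    convexOn_neg_log_comp_affine hc fun x hx => by linarith [hx.1]
  have c2 : ConvexOn ℝ (Set.Icc (0 : ℝ) 1) (fun x => -Real.log ((1 - l) + (-l) * x)) :=
    convexOn_neg_log_comp_affine hc fun x hx => by nlinarith [hx.1, hx.2]
  have c3 : ConvexOn ℝ (Set.Icc (0 : ℝ) 1) (fun x => -Real.log ((1 + l) + (-l) * x)) :=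
    convexOn_neg_log_comp_affine hc fun x hx => by nlinarith [hx.1, hx.2]
  have c4 : ConvexOn ℝ (Set.Icc (0 : ℝ) 1) (fun x => x * (-(m + 2) * l)) :=
    ⟨hc, fun x _ y _ a b _ _ _ => le_of_eq (by simp only [smul_eq_mul]; ring)⟩
  have c5 : ConvexOn ℝ (Set.Icc (0 : ℝ) 1) (fun _ =>
      1 / 16 - Real.log (Real.pi * m) / 2 - Real.log |l| - (m + 2) * (|l| * ε)) :=
    convexOn_const _ hc
  have c := ((((c2.smul (by positivity : 0 ≤ m / 2)).add
    (c3.smul (by positivity : 0 ≤ (m + 2) / 2))).add c1).add c4).add c5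
  have h := c.le_max_of_mem_Icc (x := 0) (y := 1) (z := ρ) (by simp) (by simp) ⟨h0, h1⟩
  have e : ∀ x, logTail m ε l x = ((((m / 2) • (fun x => -Real.log ((1 - l) + (-l) * x))
      + ((m + 2) / 2) • (fun x => -Real.log ((1 + l) + (-l) * x))) + (fun x => -Real.log (1 + 1 * x))
      + (fun x => x * (-(m + 2) * l))) + (fun _ =>
      1 / 16 - Real.log (Real.pi * m) / 2 - Real.log |l| - (m + 2) * (|l| * ε)) : ℝ → ℝ) x := by
    intro x
    simp only [logTail, Pi.add_apply, Pi.smul_apply, smul_eq_mul]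
    rw [show 1 - l * (1 + x) = 1 - l + -l * x by ring, show 1 + l * (1 - x) = 1 + l + -l * x by ring,
      one_mul]
    ring
  rw [e, e, e]
  exact h

/-- The hypothesis gives mε² ≥ 4(1+ε) log 2 - 2ε², which is at least 4 log 2 > 2.772 for ε < 1. -/
theorem le_mul_sq_of_log_two_le {m ε : ℝ} (hε : 0 < ε) (hε1 : ε < 1)
    (hL : Real.log 2 ≤ (m + 2) * ε ^ 2 / (4 * (1 + ε))) : 2.772 ≤ m * ε ^ 2 := by
  have h2 := Real.log_two_gt_d9
  rw [le_div_iff₀ (by linarith)] at hL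
  nlinarith

/-- Here v = 1/√m, and 0.601 exceeds 1/√2.772. The ratio r = v/ε thus stays in [0, 0.601], the range
of all later numerical bounds. -/
theorem le_mul_of_log_two_le {m ε v : ℝ} (hε : 0 < ε) (hε1 : ε < 1) (hv : 0 < v)
    (hmv : m * v ^ 2 = 1) (hL : Real.log 2 ≤ (m + 2) * ε ^ 2 / (4 * (1 + ε))) :
    v ≤ 0.601 * ε := by
  have h3 := le_mul_sq_of_log_two_le hε hε1 hL
  have h4 : 2.772 * v ^ 2 ≤ ε ^ 2 := by
    calc 2.772 * v ^ 2 ≤ m * ε ^ 2 * v ^ 2 := by gcongr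
      _ = (m * v ^ 2) * ε ^ 2 := by ring
      _ = ε ^ 2 := by rw [hmv, one_mul]
  by_contra! h
  nlinarith [mul_pos hε hε]

theorem log_pi_mul_eq {m v : ℝ} (hv : 0 < v) (hmv : m * v ^ 2 = 1) :
    Real.log (Real.pi * m) = Real.log Real.pi - 2 * Real.log v := by
  have hm' : m = (v ^ 2)⁻¹ := by field_simp; linarith
  rw [hm', Real.log_mul (by positivity) (by positivity), Real.log_inv, Real.log_pow]
  push_cast
  ring

theorem log_sub_log_add_le {ε v : ℝ} (hε : 0 < ε) (hv : 0 < v) :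
    Real.log v - Real.log (ε + v) + Real.log 3 - Real.log Real.pi / 2
      ≤ 2.7183 * (v / (ε + v)) - 1.473 := by
  rw [← Real.log_div hv.ne' (by positivity)]
  have h1 := Real.log_le_exp_one_mul_sub_two (y := v / (ε + v)) (by positivity)
  have h2 := log_three_sub_half_log_pi_le
  have h3 : Real.exp 1 * (v / (ε + v)) ≤ 2.7183 * (v / (ε + v)) := by
    gcongr
    linarith [Real.exp_one_lt_d9]
  linarith

theorem div_add_le {ε v : ℝ} (hε : 0 < ε) (hv : 0 < v) (h : v ≤ 0.601 * ε) :
    v / (ε + v) ≤ 0.3755 := by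
  rw [div_le_iff₀ (by positivity)]
  linarith

theorem logTail_upper_one {m ε v : ℝ} (hε : 0 < ε) (hε1 : ε < 1) (hv : 0 < v) (hm : 4 ≤ m)
    (hmv : m * v ^ 2 = 1) (hL : Real.log 2 ≤ (m + 2) * ε ^ 2 / (4 * (1 + ε))) :
    logTail m ε ((ε + v) / (2 * (1 + ε))) 1
      ≤ -Real.log 3 - (m + 2) * ε ^ 2 / (4 * (1 + ε)) := by
  have hr := le_mul_of_log_two_le hε hε1 hv hmv hL
  have hv1 : v ≤ 1 / 2 := by
    by_contra! h
    nlinarith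
  have hy := div_add_le hε hv hr
  have hc := log_sub_log_add_le hε hv
  have e1 : 1 - (ε + v) / (2 * (1 + ε)) * (1 + 1) = (1 - v) / (1 + ε) := by
    field_simp; ring
  rw [logTail, e1, log_pi_mul_eq hv hmv, abs_of_pos (by positivity),
    Real.log_div (by positivity) (by positivity), Real.log_div (by linarith) (by positivity),
    Real.log_mul (by norm_num) (by positivity)]
  have k1 := Real.log_one_add_le_sub hε.le
  have k2 := Real.neg_log_one_sub_le hv.le (by linarith)
  have k2' : m / 2 * -Real.log (1 - v) ≤ m / 2 * (v + v ^ 2 / (2 * (1 - v))) := by gcongr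
  have k1' : (m + 2) / 2 * Real.log (1 + ε)
      ≤ (m + 2) / 2 * (ε - ε ^ 2 / (2 * (1 + ε))) := by gcongr
  have e2 : m / 2 * (v + v ^ 2 / (2 * (1 - v))) = m / 2 * v + 1 / (4 * (1 - v)) := by
    have : 1 - v ≠ 0 := by linarith
    field_simp
    linear_combination 4 * hmv
  -- The extra v is repaid by the leftover (m/2)v - ((m+2)/2)v = -v.
  have e3 : 1 / (4 * (1 - v)) ≤ 1 / 4 + v := by
    rw [div_le_iff₀ (by linarith)]
    nlinarith
  have e4 : (m + 2) * ((ε + v) / (2 * (1 + ε)) * ε + (ε + v) / (2 * (1 + ε)) * 1)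
      = (m + 2) / 2 * (ε + v) := by
    field_simp
    ring
  have e5 : (m + 2) / 2 * (ε ^ 2 / (2 * (1 + ε))) = (m + 2) * ε ^ 2 / (4 * (1 + ε)) := by
    field_simp; ring
  rw [e4, show (1 : ℝ) + 1 = 2 by norm_num, sub_self, mul_zero, add_zero, Real.log_one]
  linarith

/-- The constant 0.7173 is 1.473 - 1/16 - log 2 rounded down: the gain in `log_sub_log_add_le`, less
the Stirling error and the 2 in the denominator of l. -/
theorem upper_endpoint_bound {r : ℝ} (hr0 : 0 ≤ r) (hr1 : r ≤ 0.601) :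
    2.7183 * (r / (1 + r)) ≤ 0.7173 - (1 - r) / 2 + 0.693 * (1 / 2 + r - r ^ 2 / 2) := by
  rw [← mul_div_assoc, div_le_iff₀ (by positivity)]
  nlinarith [sq_nonneg (r - 0.75), mul_nonneg (mul_nonneg hr0 hr0) (sub_nonneg.2 hr1)]

theorem logTail_upper_zero {m ε v : ℝ} (hε : 0 < ε) (hε1 : ε < 1) (hv : 0 < v) (hm : 4 ≤ m)
    (hmv : m * v ^ 2 = 1) (hL : Real.log 2 ≤ (m + 2) * ε ^ 2 / (4 * (1 + ε))) :
    logTail m ε ((ε + v) / (2 * (1 + ε))) 0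
      ≤ -Real.log 3 - (m + 2) * ε ^ 2 / (4 * (1 + ε)) := by
  have hr := le_mul_of_log_two_le hε hε1 hv hmv hL
  have hv1 : v ≤ 1 / 2 := by
    by_contra! h
    nlinarith
  have hc := log_sub_log_add_le hε hv
  set l := (ε + v) / (2 * (1 + ε)) with hl
  have hl0 : 0 < l := by positivity
  have hl1 : l < 1 / 2 := by rw [hl, div_lt_iff₀ (by positivity)]; linarith
  have hll : l * (1 + ε) = (ε + v) / 2 := by rw [hl]; field_simp
  have hlog : Real.log l = Real.log (ε + v) - Real.log 2 - Real.log (1 + ε) := by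
    rw [hl, Real.log_div (by positivity) (by positivity),
      Real.log_mul (by norm_num) (by positivity)]
    ring
  have k0 : Real.log (1 + ε) + Real.log (1 - l) ≤ (ε - v) / 2 := by
    rw [← Real.log_mul (by positivity) (by linarith)]
    have := Real.log_le_sub_one_of_pos (x := (1 + ε) * (1 - l)) (by
      apply mul_pos <;> linarith)
    nlinarith
  have k1 := Real.neg_log_one_sub_le (x := l ^ 2) (by positivity) (by nlinarith)
  have e0 : Real.log (1 - l ^ 2) = Real.log (1 - l) + Real.log (1 + l) := by
    rw [← Real.log_mul (by linarith) (by linarith)]; ring_nf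
  have k2 : l ^ 2 + (l ^ 2) ^ 2 / (2 * (1 - l ^ 2)) ≤ (ε + v) ^ 2 / (4 * (1 + ε)) := by
    have : (ε + v) ^ 2 / (4 * (1 + ε)) = l ^ 2 * (1 + ε) := by
      have : (ε + v) ^ 2 = 4 * (l * (1 + ε)) ^ 2 := by rw [hll]; ring
      rw [this]; field_simp
    rw [this]
    have h3 : (l ^ 2) ^ 2 / (2 * (1 - l ^ 2)) ≤ l ^ 2 * ε := by
      rw [div_le_iff₀ (by nlinarith)]
      have : l ≤ 0.8005 * ε := by nlinarith
      have : l * l ≤ 0.8005 * ε * (1 / 2) := by gcongr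
      have h5 : l ^ 2 ≤ ε * (2 * (1 - l ^ 2)) := by nlinarith
      nlinarith [sq_nonneg l]
    linarith
  set L := (m + 2) * ε ^ 2 / (4 * (1 + ε)) with hLdef
  set r := v / ε with hrdef
  have hvr : v = r * ε := by rw [hrdef]; field_simp
  have hr0 : 0 < r := by positivity
  have hr1 : r ≤ 0.601 := by rw [hrdef, div_le_iff₀ hε]; exact hr
  have hy : v / (ε + v) = r / (1 + r) := by rw [hvr]; field_simp
  have hL2 : 0.693 ≤ L := by linarith [Real.log_two_gt_d9]
  -- At ρ = 0 the exponent beats -L by a further multiple of L; the bound L ≥ 0.693 turns this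
  -- surplus into a constant.
  have hmain : (m + 2) / 2 * ((ε + v) ^ 2 / (4 * (1 + ε))) - (m + 2) * (l * ε)
      = -L - L * (1 / 2 + r - r ^ 2 / 2) := by
    rw [hLdef, hl, hvr]
    field_simp
    ring
  have hbr : 0 ≤ 1 / 2 + r - r ^ 2 / 2 := by nlinarith
  have k3 : (m + 2) / 2 * -Real.log (1 - l ^ 2)
      ≤ (m + 2) / 2 * ((ε + v) ^ 2 / (4 * (1 + ε))) := by
    gcongr
    linarith
  have k4 : 0.693 * (1 / 2 + r - r ^ 2 / 2) ≤ L * (1 / 2 + r - r ^ 2 / 2) := by gcongr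
  have k5 := upper_endpoint_bound hr0.le hr1
  have k6 : (ε - v) / 2 ≤ (1 - r) / 2 := by
    rw [hvr, show ε - r * ε = ε * (1 - r) by ring]
    have := mul_le_of_le_one_left (show 0 ≤ 1 - r by linarith) hε1.le
    linarith
  rw [hy] at hc
  rw [logTail, log_pi_mul_eq hv hmv, abs_of_pos hl0]
  rw [e0] at k3
  have h2 := Real.log_two_lt_d9
  simp only [add_zero, sub_zero, mul_one, Real.log_one, mul_zero]
  linarith

/-- Tensor Bernstein products on [0, 0.601] × [0, 1]. Each polynomial inequality below, once
denominators are cleared, is certified as a nonnegative combination of these, which `linarith`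
finds. -/
theorem bernsteinTerm_nonneg {r ε : ℝ} (hr0 : 0 ≤ r) (hr1 : r ≤ 0.601) (hε : 0 ≤ ε) (hε1 : ε ≤ 1)
    (a b c d : ℕ) : 0 ≤ r ^ a * (0.601 - r) ^ b * (ε ^ c * (1 - ε) ^ d) := by
  have h1 : 0 ≤ 0.601 - r := by linarith
  have h2 : 0 ≤ 1 - ε := by linarith
  positivity

theorem lower_one_bracket_le {r ε : ℝ} (hr0 : 0 ≤ r) (hr1 : r ≤ 0.601) (hε : 0 ≤ ε)
    (hε1 : ε ≤ 1) :
    4 * (1 + r) ^ 2 / ((2 + ε) * (2 + 2 * ε + ε * r)) - 4 * (1 + r) / (2 + ε) + 1 / (1 + ε)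
      ≤ r ^ 2 := by
  have h := bernsteinTerm_nonneg hr0 hr1 hε hε1
  have hB : 0 < 2 + 2 * ε + ε * r := by positivity
  rw [← sub_nonneg]
  have e : r ^ 2 - (4 * (1 + r) ^ 2 / ((2 + ε) * (2 + 2 * ε + ε * r)) - 4 * (1 + r) / (2 + ε)
      + 1 / (1 + ε)) = (r ^ 2 * (2 + ε) * (2 + 2 * ε + ε * r) * (1 + ε) - 4 * (1 + r) ^ 2 * (1 + ε)
        + 4 * (1 + r) * (2 + 2 * ε + ε * r) * (1 + ε) - (2 + ε) * (2 + 2 * ε + ε * r))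
        / ((2 + ε) * (2 + 2 * ε + ε * r) * (1 + ε)) := by
    field_simp
    ring
  rw [e]
  refine div_nonneg ?_ (by positivity)
  linarith [
     h 0 3 0 3, h 0 3 1 2, h 0 3 2 1, h 0 3 3 0, h 1 2 0 3, h 1 2 1 2, h 1 2 2 1, h 1 2 3 0,
      h 2 1 0 3, h 2 1 1 2, h 2 1 2 1, h 2 1 3 0, h 3 0 0 3, h 3 0 1 2, h 3 0 2 1, h 3 0 3 0]

/-- Here 1.1605 = 1.473 - 1/16 - 1/4, the 1/4 being mv²/4. -/
theorem lower_one_endpoint_bound {r ε : ℝ} (hr0 : 0 ≤ r) (hr1 : r ≤ 0.601) (hε : 0 ≤ ε)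
    (hε1 : ε ≤ 1) :
    0.693 * (4 * (1 + r) ^ 2 / ((2 + ε) * (2 + 2 * ε + ε * r)) - 4 * (1 + r) / (2 + ε)
        + 1 / (1 + ε) - r ^ 2) + ε ^ 2 / (2 * (1 + ε)) + ε / 2
      + 2 * ε * (1 + r) / (2 + ε) * (1 - ε) + 2.7183 * (r / (1 + r)) ≤ 1.1605 := by
  have h := bernsteinTerm_nonneg hr0 hr1 hε hε1
  have hB : 0 < 2 + 2 * ε + ε * r := by positivity
  rw [← sub_nonneg]
  have e : 1.1605 - (0.693 * (4 * (1 + r) ^ 2 / ((2 + ε) * (2 + 2 * ε + ε * r))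
        - 4 * (1 + r) / (2 + ε) + 1 / (1 + ε) - r ^ 2) + ε ^ 2 / (2 * (1 + ε)) + ε / 2
      + 2 * ε * (1 + r) / (2 + ε) * (1 - ε) + 2.7183 * (r / (1 + r)))
      = (1.1605 * ((2 + ε) * (2 + 2 * ε + ε * r) * (1 + ε) * (1 + r))
        - (0.693 * (4 * (1 + r) ^ 2 * (1 + ε) - 4 * (1 + r) * (2 + 2 * ε + ε * r) * (1 + ε)
            + (2 + ε) * (2 + 2 * ε + ε * r)
            - r ^ 2 * ((2 + ε) * (2 + 2 * ε + ε * r) * (1 + ε))) * (1 + r)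
          + ε ^ 2 / 2 * ((2 + ε) * (2 + 2 * ε + ε * r) * (1 + r))
          + ε / 2 * ((2 + ε) * (2 + 2 * ε + ε * r) * (1 + ε) * (1 + r))
          + 2 * ε * (1 + r) * (1 - ε) * ((2 + 2 * ε + ε * r) * (1 + ε) * (1 + r))
          + 2.7183 * r * ((2 + ε) * (2 + 2 * ε + ε * r) * (1 + ε))))
        / ((2 + ε) * (2 + 2 * ε + ε * r) * (1 + ε) * (1 + r)) := by
    field_simp
  rw [e]
  refine div_nonneg ?_ (by positivity)
  linarith [
     h 0 4 0 4, h 0 4 1 3, h 0 4 2 2, h 0 4 3 1, h 0 4 4 0, h 1 3 0 4, h 1 3 1 3, h 1 3 2 2,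
      h 1 3 3 1, h 1 3 4 0, h 2 2 0 4, h 2 2 1 3, h 2 2 2 2, h 2 2 3 1, h 2 2 4 0, h 3 1 0 4,
      h 3 1 1 3, h 3 1 2 2, h 3 1 3 1, h 3 1 4 0, h 4 0 0 4, h 4 0 1 3, h 4 0 2 2, h 4 0 3 1,
      h 4 0 4 0]

theorem lower_zero_bracket_nonpos {r ε : ℝ} (hr0 : 0 ≤ r) (hr1 : r ≤ 0.601) (hε : 0 ≤ ε)
    (hε1 : ε ≤ 1) :
    2 * ((1 + r) / (2 + ε)) ^ 2 * (1 + ε / 5) - 4 * ((1 + r) / (2 + ε)) + 1 / (1 + ε) ≤ 0 := by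
  have h := bernsteinTerm_nonneg hr0 hr1 hε hε1
  rw [← neg_nonneg]
  have e : -(2 * ((1 + r) / (2 + ε)) ^ 2 * (1 + ε / 5) - 4 * ((1 + r) / (2 + ε)) + 1 / (1 + ε))
      = (-(2 * (1 + r) ^ 2 * (1 + ε / 5) * (1 + ε)) + 4 * (1 + r) * (2 + ε) * (1 + ε)
        - (2 + ε) ^ 2) / ((2 + ε) ^ 2 * (1 + ε)) := by
    field_simp
    ring
  rw [e]
  refine div_nonneg ?_ (by positivity)
  linarith [
     h 0 2 0 2, h 0 2 1 1, h 0 2 2 0, h 1 1 0 2, h 1 1 1 1, h 1 1 2 0, h 2 0 0 2, h 2 0 1 1,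
      h 2 0 2 0]

theorem lower_zero_endpoint_bound {r ε : ℝ} (hr0 : 0 ≤ r) (hr1 : r ≤ 0.601) (hε : 0 ≤ ε)
    (hε1 : ε ≤ 1) :
    ε * (1 + r / 2) - 0.217 * (ε * (1 + r / 2)) ^ 2
      + 0.693 * (1 + ε) * (2 * ((1 + r) / (2 + ε)) ^ 2 * (1 + ε / 5)
      - 4 * ((1 + r) / (2 + ε)) + 1 / (1 + ε)) + 2.7183 * (r / (1 + r)) ≤ 0.7173 := by
  have h := bernsteinTerm_nonneg hr0 hr1 hε hε1
  rw [← sub_nonneg]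
  have e : 0.7173 - (ε * (1 + r / 2) - 0.217 * (ε * (1 + r / 2)) ^ 2
      + 0.693 * (1 + ε) * (2 * ((1 + r) / (2 + ε)) ^ 2
      * (1 + ε / 5) - 4 * ((1 + r) / (2 + ε)) + 1 / (1 + ε)) + 2.7183 * (r / (1 + r)))
      = (0.7173 * ((2 + ε) ^ 2 * (1 + r))
        - ((ε * (1 + r / 2) - 0.217 * (ε * (1 + r / 2)) ^ 2) * ((2 + ε) ^ 2 * (1 + r))
        + 0.693 * (2 * (1 + r) ^ 2 * (1 + ε / 5) * (1 + ε) - 4 * (1 + r) * (2 + ε) * (1 + ε)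
          + (2 + ε) ^ 2) * (1 + r) + 2.7183 * r * (2 + ε) ^ 2)) / ((2 + ε) ^ 2 * (1 + r)) := by
    field_simp
  rw [e]
  refine div_nonneg ?_ (by positivity)
  linarith [
     h 0 3 0 4, h 0 3 1 3, h 0 3 2 2, h 0 3 3 1, h 0 3 4 0, h 1 2 0 4, h 1 2 1 3, h 1 2 2 2,
      h 1 2 3 1, h 1 2 4 0, h 2 1 0 4, h 2 1 1 3, h 2 1 2 2, h 2 1 3 1, h 2 1 4 0, h 3 0 0 4,
      h 3 0 1 3, h 3 0 2 2, h 3 0 3 1, h 3 0 4 0]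

theorem logTail_lower_one {m ε v : ℝ} (hε : 0 < ε) (hε1 : ε < 1) (hv : 0 < v) (hm : 4 ≤ m)
    (hmv : m * v ^ 2 = 1) (hL : Real.log 2 ≤ (m + 2) * ε ^ 2 / (4 * (1 + ε))) :
    logTail m ε (-((ε + v) / (2 + ε))) 1
      ≤ -Real.log 3 - (m + 2) * ε ^ 2 / (4 * (1 + ε)) := by
  have hr := le_mul_of_log_two_le hε hε1 hv hmv hL
  have hc := log_sub_log_add_le hε hv
  have hmε := le_mul_sq_of_log_two_le hε hε1 hL
  obtain ⟨r, rfl⟩ : ∃ r, v = r * ε := ⟨v / ε, by field_simp⟩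
  have hr0 : 0 < r := pos_of_mul_pos_left hv hε.le
  have hr1 : r ≤ 0.601 := le_of_mul_le_mul_right hr hε
  have hy : r * ε / (ε + r * ε) = r / (1 + r) := by field_simp
  rw [hy] at hc
  set u := 2 * ε * (1 + r) / (2 + ε) with hu
  have hu0 : 0 < u := by positivity
  have hul : (ε + r * ε) / (2 + ε) = u / 2 := by rw [hu]; field_simp
  have hlog : Real.log (u / 2) = Real.log (ε + r * ε) - Real.log (2 + ε) := by
    rw [← hul, Real.log_div (by positivity) (by positivity)]
  have k0 : Real.log (2 + ε) - Real.log 2 ≤ ε / 2 := by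
    rw [← Real.log_div (by positivity) (by norm_num)]
    have := Real.log_le_sub_one_of_pos (x := (2 + ε) / 2) (by positivity)
    linarith
  have k1 : m / 2 * (2 * u / (u + 2)) ≤ m / 2 * Real.log (1 + u) := by
    gcongr
    exact Real.le_log_one_add_of_nonneg hu0.le
  have k2 := lower_one_bracket_le hr0.le hr1 hε.le hε1.le
  have k3 := lower_one_endpoint_bound hr0.le hr1 hε.le hε1.le
  set b := 4 * (1 + r) ^ 2 / ((2 + ε) * (2 + 2 * ε + ε * r)) - 4 * (1 + r) / (2 + ε)
    + 1 / (1 + ε) with hb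
  have e1 : (m + 2) / 2 * (u * (1 - ε)) - m / 2 * (2 * u / (u + 2))
      + (m + 2) * ε ^ 2 / (4 * (1 + ε))
      = u * (1 - ε) + ε ^ 2 / (2 * (1 + ε)) + 1 / 4 + m * ε ^ 2 / 4 * (b - r ^ 2) := by
    have h1 : 2 * u / (u + 2) = 2 * ε * (1 + r) / (2 + 2 * ε + ε * r) := by
      rw [hu]; field_simp; ring
    have h2 : (1 : ℝ) / 4 = m * (r * ε) ^ 2 / 4 := by rw [hmv]
    rw [h1, h2, hb, hu]
    field_simp
    ring
  -- The bracket is nonpositive, so mε²/4 may be replaced by its lower bound 2.772/4; this removes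
  -- m.
  have k4 : m * ε ^ 2 / 4 * (b - r ^ 2) ≤ 0.693 * (b - r ^ 2) :=
    mul_le_mul_of_nonpos_right (by linarith) (by linarith)
  rw [logTail, log_pi_mul_eq hv hmv, abs_neg, abs_of_pos (by positivity), hul, hlog,
    show 1 - -(u / 2) * (1 + 1) = 1 + u by ring, show (1 : ℝ) + 1 = 2 by norm_num, sub_self,
    mul_zero, add_zero, Real.log_one]
  linarith

theorem logTail_lower_zero {m ε v : ℝ} (hε : 0 < ε) (hε1 : ε < 1) (hv : 0 < v) (hm : 4 ≤ m)
    (hmv : m * v ^ 2 = 1) (hL : Real.log 2 ≤ (m + 2) * ε ^ 2 / (4 * (1 + ε))) :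
    logTail m ε (-((ε + v) / (2 + ε))) 0
      ≤ -Real.log 3 - (m + 2) * ε ^ 2 / (4 * (1 + ε)) := by
  have hr := le_mul_of_log_two_le hε hε1 hv hmv hL
  have hc := log_sub_log_add_le hε hv
  obtain ⟨r, rfl⟩ : ∃ r, v = r * ε := ⟨v / ε, by field_simp⟩
  have hr0 : 0 < r := pos_of_mul_pos_left hv hε.le
  have hr1 : r ≤ 0.601 := le_of_mul_le_mul_right hr hε
  have hy : r * ε / (ε + r * ε) = r / (1 + r) := by field_simp
  rw [hy] at hc
  set g := (1 + r) / (2 + ε) with hg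
  have hg0 : 0 < g := by positivity
  have hul : (ε + r * ε) / (2 + ε) = ε * g := by rw [hg]; field_simp
  have hlog : Real.log (ε * g) = Real.log (ε + r * ε) - Real.log (2 + ε) := by
    rw [← hul, Real.log_div (by positivity) (by positivity)]
  have hgε : ε * g ≤ 0.534 := by
    rw [← hul, div_le_iff₀ (by positivity)]
    nlinarith
  have hεg2 : ε * g ^ 2 ≤ 0.285 := by
    rw [hg, div_pow, ← mul_div_assoc, div_le_iff₀ (by positivity)]
    have h1 : (1 + r) ^ 2 ≤ 1.601 ^ 2 := by gcongr; linarith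
    nlinarith [mul_nonneg (sub_nonneg.2 hε1.le) (by linarith : 0 ≤ 4 - ε)]
  have k0 : Real.log (1 + ε * g) + Real.log (2 + ε) - Real.log 2
      ≤ ε * (1 + r / 2) - 0.217 * (ε * (1 + r / 2)) ^ 2 := by
    have e : (1 + ε * g) * (2 + ε) / 2 = 1 + ε * (1 + r / 2) := by
      rw [hg]; field_simp; ring
    rw [← Real.log_mul (by positivity) (by positivity),
      ← Real.log_div (by positivity) (by norm_num), e]
    refine (Real.log_one_add_le_sub (by positivity)).trans ?_
    have : 0.217 * (ε * (1 + r / 2)) ^ 2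
        ≤ (ε * (1 + r / 2)) ^ 2 / (2 * (1 + ε * (1 + r / 2))) := by
      rw [le_div_iff₀ (by positivity)]
      have h1 : ε * (1 + r / 2) ≤ 1.301 := by nlinarith
      have h2 : 0.217 * (2 * (1 + ε * (1 + r / 2))) ≤ 1 := by linarith
      have := mul_le_of_le_one_right (sq_nonneg (ε * (1 + r / 2))) h2
      linarith
    linarith
  have hl1 : (ε * g) ^ 2 ≤ 0.286 := by nlinarith [mul_pos hε hg0]
  have k1 : -Real.log (1 - (ε * g) ^ 2) ≤ (ε * g) ^ 2 * (1 + ε / 5) := by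
    refine (Real.neg_log_one_sub_le (by positivity) (by linarith)).trans ?_
    have : ((ε * g) ^ 2) ^ 2 / (2 * (1 - (ε * g) ^ 2)) ≤ (ε * g) ^ 2 * (ε / 5) := by
      rw [div_le_iff₀ (by linarith)]
      have h1 : (ε * g) ^ 2 ≤ ε * 0.285 := by
        rw [show (ε * g) ^ 2 = ε * (ε * g ^ 2) by ring]; gcongr
      have h2 : ε * 0.285 ≤ ε / 5 * (2 * (1 - (ε * g) ^ 2)) := by nlinarith
      rw [sq ((ε * g) ^ 2), mul_assoc]
      gcongr
      linarith
    linarith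
  have e0 : Real.log (1 - (ε * g) ^ 2) = Real.log (1 - ε * g) + Real.log (1 + ε * g) := by
    rw [← Real.log_mul (by linarith) (by positivity)]; ring_nf
  have k2 : (m + 2) / 2 * -Real.log (1 - (ε * g) ^ 2)
      ≤ (m + 2) / 2 * ((ε * g) ^ 2 * (1 + ε / 5)) := by gcongr
  rw [e0] at k2
  have k3 := lower_zero_bracket_nonpos hr0.le hr1 hε.le hε1.le
  have k4 := lower_zero_endpoint_bound hr0.le hr1 hε.le hε1.le
  rw [← hg] at k3 k4
  set b := 2 * g ^ 2 * (1 + ε / 5) - 4 * g + 1 / (1 + ε) with hb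
  have e1 : (m + 2) / 2 * ((ε * g) ^ 2 * (1 + ε / 5)) - (m + 2) * (ε * g * ε)
      = (m + 2) * ε ^ 2 / (4 * (1 + ε)) * (1 + ε) * b - (m + 2) * ε ^ 2 / (4 * (1 + ε)) := by
    rw [hb]
    field_simp
    ring
  have h2 := Real.log_two_gt_d9
  -- Again b ≤ 0, so L may be lowered to 0.693 < log 2.
  have k5 : (m + 2) * ε ^ 2 / (4 * (1 + ε)) * (1 + ε) * b ≤ 0.693 * (1 + ε) * b := by
    apply mul_le_mul_of_nonpos_right _ k3
    gcongr
    linarith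
  rw [logTail, log_pi_mul_eq hv hmv, abs_neg, abs_of_pos (by positivity), hul, hlog,
    add_zero, sub_zero, mul_one, mul_zero, add_zero, Real.log_one,
    sub_neg_eq_add, ← sub_eq_add_neg]
  have h3 := Real.log_two_lt_d9
  linarith

/-- The tilts start from ε/(2(1+ε)), the Chernoff optimum for the upper tail at ρ = 1, and -ε/(2+ε),
which agrees with the lower-tail optimum at ρ = 1 to first order in ε. Enlarging ε to ε + 1/√m in
the numerator shrinks the prefactor 1/|l| at bounded cost in the exponent. -/
theorem exists_logTail_le {m ε : ℝ} (hε : 0 < ε) (hε1 : ε < 1) (hm : 4 ≤ m)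
    (hL : Real.log 2 ≤ (m + 2) * ε ^ 2 / (4 * (1 + ε))) :
    (∃ l, 0 < l ∧ l < 1 / 2 ∧ ∀ ρ, 0 ≤ ρ → ρ ≤ 1 →
      logTail m ε l ρ ≤ -Real.log 3 - (m + 2) * ε ^ 2 / (4 * (1 + ε))) ∧
    (∃ l, -1 < l ∧ l < 0 ∧ ∀ ρ, 0 ≤ ρ → ρ ≤ 1 →
      logTail m ε l ρ ≤ -Real.log 3 - (m + 2) * ε ^ 2 / (4 * (1 + ε))) := by
  have hm0 : 0 < m := by linarith
  have hv : 0 < (√m)⁻¹ := by positivity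
  have hmv : m * (√m)⁻¹ ^ 2 = 1 := by
    rw [inv_pow, Real.sq_sqrt hm0.le, mul_inv_cancel₀ hm0.ne']
  have hv1 : (√m)⁻¹ ≤ 1 / 2 := by
    by_contra! h
    nlinarith
  have hu : (ε + (√m)⁻¹) / (2 * (1 + ε)) < 1 / 2 := by
    rw [div_lt_iff₀ (by positivity)]; linarith
  have hl : (ε + (√m)⁻¹) / (2 + ε) < 1 := by
    rw [div_lt_iff₀ (by positivity)]; linarith
  have hu0 : 0 < (ε + (√m)⁻¹) / (2 * (1 + ε)) := by positivity
  have hl0 : 0 < (ε + (√m)⁻¹) / (2 + ε) := by positivity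
  refine ⟨⟨_, hu0, hu, fun ρ h0 h1 => ?_⟩, ⟨_, neg_lt_neg hl, neg_neg_of_pos hl0, fun ρ h0 h1 => ?_⟩⟩
  · exact (logTail_le_max hm0.le hu (by linarith) h0 h1).trans
      (max_le (logTail_upper_zero hε hε1 hv hm hmv hL) (logTail_upper_one hε hε1 hv hm hmv hL))
  · exact (logTail_le_max hm0.le (by linarith) (neg_lt_neg hl) h0 h1).trans
      (max_le (logTail_lower_zero hε hε1 hv hm hmv hL) (logTail_lower_one hε hε1 hv hm hmv hL))

/-! ### Stirling's lower bound at half-integers -/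

theorem log_Gamma_half_add_one_ge {n : ℕ} (hn : 4 ≤ n) :
    (n / 2 : ℝ) * Real.log (n / 2) - n / 2 + Real.log (Real.pi * n) / 2 - 1 / 16
      ≤ Real.log (Real.Gamma (n / 2 + 1)) := by
  have hpi := Real.pi_pos
  rcases Nat.even_or_odd' n with ⟨j, rfl | rfl⟩
  · have hj : 0 < j := by omega
    have hj' : (0 : ℝ) < j := by exact_mod_cast hj
    have h := Stirling.le_log_factorial_stirling hj.ne'
    have e : (((2 * j : ℕ) : ℝ) / 2) = j := by push_cast; ring
    rw [e, Real.Gamma_nat_eq_factorial]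
    have e2 : Real.log (Real.pi * (2 * j : ℕ)) = Real.log j + Real.log (2 * Real.pi) := by
      rw [← Real.log_mul (by positivity) (by positivity)]; push_cast; ring_nf
    rw [e2]
    linarith
  · have hj : 2 ≤ j := by omega
    have hj' : (2 : ℝ) ≤ j := by exact_mod_cast hj
    have h := Stirling.le_log_factorial_stirling (n := j) (by omega)
    set s : ℝ := j + 1 / 2 with hs
    have e : (((2 * j + 1 : ℕ) : ℝ) / 2) = s := by rw [hs]; push_cast; ring
    rw [e]
    have hs0 : 0 < s := by positivity
    -- Log-convexity at the midpoint j + 1 of s and s + 1, with Γ(s+1) = sΓ(s), gives log Γ(s+1) ≥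
    -- log j! + (log s)/2. Passing from log j to log s costs 1/(8j) ≤ 1/16.
    have hconv := Real.convexOn_log_Gamma.2 (Set.mem_Ioi.2 hs0)
      (Set.mem_Ioi.2 (by linarith : 0 < s + 1)) (by norm_num : (0 : ℝ) ≤ 1 / 2)
      (by norm_num : (0 : ℝ) ≤ 1 / 2) (by norm_num)
    have e3 : (1 / 2 : ℝ) • s + (1 / 2 : ℝ) • (s + 1) = j + 1 := by
      simp only [smul_eq_mul, hs]; ring
    rw [e3] at hconv
    simp only [Function.comp_apply, smul_eq_mul] at hconv
    have e4 : Real.log (Real.Gamma (s + 1)) = Real.log s + Real.log (Real.Gamma s) := by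
      rw [Real.Gamma_add_one hs0.ne', Real.log_mul hs0.ne' (Real.Gamma_pos_of_pos hs0).ne']
    rw [Real.Gamma_nat_eq_factorial] at hconv
    have h1 := Real.log_le_half_sub_inv (x := s / j) (by
      rw [le_div_iff₀ (by linarith)]; linarith)
    rw [Real.log_div hs0.ne' (by linarith)] at h1
    have h2 : s * (Real.log s - Real.log j) ≤ s * ((s / j - (s / j)⁻¹) / 2) := by gcongr
    have h3 : s * ((s / j - (s / j)⁻¹) / 2) ≤ 1 / 2 + 1 / 16 := by
      have : s * ((s / j - (s / j)⁻¹) / 2) = 1 / 2 + 1 / (8 * j) := by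
        rw [hs]; field_simp; ring
      rw [this]
      have : 1 / (8 * (j : ℝ)) ≤ 1 / 16 := by
        apply one_div_le_one_div_of_le <;> linarith
      linarith
    have e5 : Real.log (Real.pi * (2 * j + 1 : ℕ)) = Real.log s + Real.log (2 * Real.pi) := by
      rw [← Real.log_mul (by positivity) (by positivity), hs]; push_cast; ring_nf
    have h5 : s * Real.log j = j * Real.log j + Real.log j / 2 := by rw [hs]; ring
    have h6 : s - j = 1 / 2 := by rw [hs]; ring
    rw [e5]
    linarith

/-! ### Sums of Gaussian squares and the gamma law -/

section SumSquares

variable {Ω : Type*} [MeasurableSpace Ω] {P : Measure Ω}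

/-- For t ≥ 1/2 both sides are 0: the integral diverges, and the root is of a nonpositive number. -/
theorem mgf_sq_of_hasLaw_gaussianReal {Y : Ω → ℝ} (hY : HasLaw Y (gaussianReal 0 1) P) (t : ℝ) :
    mgf (fun ω => Y ω ^ 2) P t = √((1 - 2 * t)⁻¹) := by
  have h1 : mgf (fun ω => Y ω ^ 2) P t = ∫ x, Real.exp (t * x ^ 2) ∂(gaussianReal 0 1) :=
    hY.integral_comp (f := fun x => Real.exp (t * x ^ 2)) (by fun_prop)
  rw [h1, integral_gaussianReal_eq_integral_smul (by norm_num)]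
  have h2 : ∀ x : ℝ, gaussianPDFReal 0 1 x • Real.exp (t * x ^ 2)
      = (√(2 * Real.pi))⁻¹ * Real.exp (-(1 / 2 - t) * x ^ 2) := by
    intro x
    rw [gaussianPDFReal, smul_eq_mul, mul_assoc, ← Real.exp_add]
    simp only [NNReal.coe_one, mul_one, sub_zero]
    ring_nf
  simp_rw [h2]
  rw [integral_const_mul, integral_gaussian, ← Real.sqrt_inv, ← Real.sqrt_mul (by positivity)]
  congr 1
  rw [show 1 - 2 * t = 2 * (1 / 2 - t) by ring, mul_inv, mul_inv, div_eq_mul_inv]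
  field_simp

theorem mgf_gammaMeasure {k : ℝ} (hk : 0 < k) (t : ℝ) :
    mgf id (gammaMeasure k (1 / 2)) t = if t < 1 / 2 then (1 - 2 * t) ^ (-k) else 0 := by
  have hd : ∀ᵐ x ∂(volume : Measure ℝ), gammaPDF k (1 / 2) x < ∞ :=
    ae_of_all _ fun x => ENNReal.ofReal_lt_top
  rw [mgf, gammaMeasure, integral_withDensity_eq_integral_toReal_smul₀
    (by unfold gammaPDF; fun_prop) hd]
  have h0 : ∀ x, (gammaPDF k (1 / 2) x).toReal • Real.exp (t * id x)
      = (Set.Ici (0 : ℝ)).indicator (fun x => (1 / 2) ^ k / Real.Gamma k *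
        (x ^ (k - 1) * Real.exp (-((1 / 2 - t) * x)))) x := by
    intro x
    rw [gammaPDF, ENNReal.toReal_ofReal (gammaPDFReal_nonneg hk (by norm_num) x), gammaPDFReal]
    by_cases hx : 0 ≤ x
    · rw [if_pos hx, Set.indicator_of_mem (Set.mem_Ici.2 hx), smul_eq_mul, mul_assoc, mul_assoc,
        ← Real.exp_add]
      simp only [id]
      ring_nf
    · rw [if_neg hx, Set.indicator_of_notMem (by simpa using hx), zero_smul]
  simp_rw [h0]
  rw [integral_indicator measurableSet_Ici, integral_Ici_eq_integral_Ioi, integral_const_mul]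
  have hG := (Real.Gamma_pos_of_pos hk).ne'
  split_ifs with ht
  · rw [Real.integral_rpow_mul_exp_neg_mul_Ioi hk (by linarith)]
    have hw : 0 < 1 / 2 - t := by linarith
    have hw' := (Real.rpow_pos_of_pos hw k).ne'
    rw [show 1 - 2 * t = 2 * (1 / 2 - t) by ring, Real.rpow_neg (by positivity),
      Real.mul_rpow (by norm_num) hw.le, Real.div_rpow (by norm_num) hw.le,
      Real.div_rpow (by norm_num) (by norm_num), Real.one_rpow]
    set w := (1 / 2 - t) ^ k
    field_simp
  · rw [integral_undef, mul_zero]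
    intro hi
    -- For t ≥ 1/2 the exponential factor is at least 1, so integrability would pass to x^(k-1) on
    -- (0, ∞).
    refine not_integrableOn_Ioi_rpow (k - 1) (Integrable.mono' hi (by fun_prop) ?_)
    refine (ae_restrict_iff' measurableSet_Ioi).2 (ae_of_all _ fun x (hx : 0 < x) => ?_)
    rw [Real.norm_of_nonneg (by positivity)]
    refine le_mul_of_one_le_right (by positivity) (Real.one_le_exp ?_)
    nlinarith

/-- The mgfs agree everywhere, so the complex mgfs agree on the strip over the interior of the
integrability set. That strip contains the imaginary axis, where they are the characteristic
functions. -/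
theorem hasLaw_sum_sq_gammaMeasure {q : ℕ} (hq : 0 < q) {Y : Fin q → Ω → ℝ}
    (hY : ∀ i, HasLaw (Y i) (gaussianReal 0 1) P) (hind : iIndepFun Y P) :
    HasLaw (fun ω => ∑ i, Y i ω ^ 2) (gammaMeasure (q / 2) (1 / 2)) P := by
  have := hind.isProbabilityMeasure
  have hk : (0 : ℝ) < q / 2 := by positivity
  have := isProbabilityMeasure_gammaMeasure hk (by norm_num : (0 : ℝ) < 1 / 2)
  have hm : ∀ i, AEMeasurable (fun ω => Y i ω ^ 2) P := fun i => (hY i).aemeasurable.pow_const 2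
  have hsum : AEMeasurable (fun ω => ∑ i, Y i ω ^ 2) P := by fun_prop
  have hmgf : mgf (fun ω => ∑ i, Y i ω ^ 2) P = mgf id (gammaMeasure (q / 2) (1 / 2)) := by
    ext t
    have e : (fun ω => ∑ i, Y i ω ^ 2) = ∑ i, fun ω => Y i ω ^ 2 := by
      ext ω; simp
    have hi := hind.comp (fun _ x => x ^ 2) (fun _ => by fun_prop)
    rw [mgf_gammaMeasure hk, e]
    rw [show (∑ i, fun ω => Y i ω ^ 2) = ∑ i, ((fun x : ℝ => x ^ 2) ∘ Y i) from rfl,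
      hi.mgf_sum₀ hm]
    have : ∀ i, mgf ((fun x : ℝ => x ^ 2) ∘ Y i) P t = √((1 - 2 * t)⁻¹) :=
      fun i => mgf_sq_of_hasLaw_gaussianReal (hY i) t
    simp_rw [this]
    rw [Finset.prod_const, Finset.card_univ, Fintype.card_fin]
    split_ifs with ht
    · have : 0 < 1 - 2 * t := by linarith
      rw [Real.sqrt_eq_rpow, ← Real.rpow_natCast, ← Real.rpow_mul (by positivity),
        Real.inv_rpow this.le, ← Real.rpow_neg this.le]
      ring_nf
    · rw [Real.sqrt_eq_zero_of_nonpos (inv_nonpos.2 (by linarith)), zero_pow hq.ne']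
  have hexp : integrableExpSet (fun ω => ∑ i, Y i ω ^ 2) P = Set.Iio (1 / 2) := by
    ext t
    rw [integrableExpSet, Set.mem_ofPred_eq, ← mgf_pos_iff, hmgf, mgf_gammaMeasure hk]
    split_ifs with ht
    · have : 0 < 1 - 2 * t := by linarith
      exact iff_of_true (by positivity) ht
    · exact iff_of_false (lt_irrefl 0) ht
  have heq := eqOn_complexMGF_of_mgf hmgf
  rw [hexp, interior_Iio] at heq
  refine ⟨hsum, Measure.ext_of_charFun ?_⟩
  ext t
  have := heq (x := t * Complex.I) (by simp)
  rw [complexMGF_mul_I hsum, complexMGF_mul_I aemeasurable_id] at this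
  simpa using this

end SumSquares

/-! ### Exponential tail bounds and independent sums -/

/-- The function x^(k-1) e^{-(1/2-θ)x} is largest at x = (k-1)/(1/2-θ); log y ≤ y - 1 at the
rescaled point expresses this. -/
theorem gammaPDFReal_le_exp {k θ : ℝ} (hk : 1 < k) (hθ : θ < 1 / 2) (x : ℝ) :
    gammaPDFReal k (1 / 2) x ≤ (1 / 2) ^ k / Real.Gamma k
      * ((k - 1) / (Real.exp 1 * (1 / 2 - θ))) ^ (k - 1) * Real.exp (-θ * x) := by
  have hG := Real.Gamma_pos_of_pos (by linarith : 0 < k)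
  have hk1 : 0 < k - 1 := by linarith
  have hr : 0 < 1 / 2 - θ := by linarith
  rw [gammaPDFReal]
  split_ifs with hx
  · rw [mul_assoc, mul_assoc]
    refine mul_le_mul_of_nonneg_left ?_ (by positivity)
    rcases hx.eq_or_lt with rfl | hx
    · rw [Real.zero_rpow hk1.ne', zero_mul]
      positivity
    · rw [Real.rpow_def_of_pos hx, Real.rpow_def_of_pos (by positivity), ← Real.exp_add,
        ← Real.exp_add, Real.exp_le_exp]
      have h := Real.log_le_sub_one_of_pos (x := x / ((k - 1) / (1 / 2 - θ))) (by positivity)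
      rw [Real.log_div hx.ne' (by positivity), Real.log_div hk1.ne' hr.ne'] at h
      rw [Real.log_div hk1.ne' (by positivity), Real.log_mul (by positivity) hr.ne', Real.log_exp]
      have h2 : (k - 1) * (x / ((k - 1) / (1 / 2 - θ))) = (1 / 2 - θ) * x := by
        field_simp
      nlinarith
  · positivity

theorem setLIntegral_exp_neg_mul {θ : ℝ} (hθ : θ ≠ 0) (x₀ : ℝ) :
    ∫⁻ x in {x | θ * x₀ ≤ θ * x}, ENNReal.ofReal (Real.exp (-θ * x))
      = ENNReal.ofReal (Real.exp (-θ * x₀) / |θ|) := by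
  rcases hθ.lt_or_gt with h | h
  · have hs : {x | θ * x₀ ≤ θ * x} = Set.Iic x₀ := by
      ext x
      simp [mul_le_mul_left_of_neg h]
    rw [hs, ← ofReal_integral_eq_lintegral_ofReal (integrableOn_exp_mul_Iic (by linarith) _)
      (ae_of_all _ fun x => (Real.exp_pos _).le), integral_exp_mul_Iic (by linarith),
      abs_of_neg h]
  · have hs : {x | θ * x₀ ≤ θ * x} = Set.Ici x₀ := by
      ext x
      simp [mul_le_mul_iff_right₀ h]
    rw [hs, setLIntegral_congr Ioi_ae_eq_Ici.symm,
      ← ofReal_integral_eq_lintegral_ofReal (integrableOn_exp_mul_Ioi (by linarith) _)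
      (ae_of_all _ fun x => (Real.exp_pos _).le), integral_exp_mul_Ioi (by linarith),
      abs_of_pos h, neg_div_neg_eq]

theorem gammaMeasure_tail_le {k θ : ℝ} (hk : 1 < k) (hθ : θ < 1 / 2) (hθ0 : θ ≠ 0) (x₀ : ℝ) :
    gammaMeasure k (1 / 2) {x | θ * x₀ ≤ θ * x} ≤ ENNReal.ofReal ((1 / 2) ^ k / Real.Gamma k
      * ((k - 1) / (Real.exp 1 * (1 / 2 - θ))) ^ (k - 1) * (Real.exp (-θ * x₀) / |θ|)) := by
  have hG := Real.Gamma_pos_of_pos (by linarith : 0 < k)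
  have hk1 : 0 < k - 1 := by linarith
  have hr : 0 < 1 / 2 - θ := by linarith
  have hs : MeasurableSet {x : ℝ | θ * x₀ ≤ θ * x} :=
    measurableSet_le (by fun_prop) (by fun_prop)
  rw [gammaMeasure, withDensity_apply _ hs, ENNReal.ofReal_mul (by positivity),
    ← setLIntegral_exp_neg_mul hθ0, ← lintegral_const_mul _ (by fun_prop)]
  refine lintegral_mono fun x => ?_
  rw [← ENNReal.ofReal_mul (by positivity), gammaPDF]
  exact ENNReal.ofReal_le_ofReal (gammaPDFReal_le_exp hk hθ x)

section Compose

variable {Ω : Type*} [MeasurableSpace Ω] {P : Measure Ω} [IsProbabilityMeasure P]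

/-- An exponential tail bound for `X` survives adding an independent variable. -/
theorem measure_le_add_le_of_indepFun {X W : Ω → ℝ} (hX : AEMeasurable X P)
    (hW : AEMeasurable W P) (hXW : IndepFun X W P) {C θ : ℝ} (hC : 0 ≤ C)
    (htail : ∀ x₀, P.map X {x | θ * x₀ ≤ θ * x} ≤ ENNReal.ofReal (C * Real.exp (-θ * x₀)))
    (hθ : θ ≠ 0) (c : ℝ) (hint : Integrable (fun ω => Real.exp (W ω)) P) :
    P {ω | c ≤ θ * X ω + W ω} ≤ ENNReal.ofReal (C * Real.exp (-c) * mgf W P 1) := by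
  have hs : MeasurableSet {p : ℝ × ℝ | c ≤ θ * p.1 + p.2} :=
    measurableSet_le (by fun_prop) (by fun_prop)
  have h1 : P {ω | c ≤ θ * X ω + W ω} = (P.map fun ω => (X ω, W ω)) {p | c ≤ θ * p.1 + p.2} := by
    rw [Measure.map_apply_of_aemeasurable (by fun_prop) hs]
    rfl
  rw [h1, (indepFun_iff_map_prod_eq_prod_map_map hX hW).1 hXW, Measure.prod_apply_symm hs]
  calc ∫⁻ y, P.map X ((fun x => (x, y)) ⁻¹' {p | c ≤ θ * p.1 + p.2}) ∂(P.map W)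
      ≤ ∫⁻ y, ENNReal.ofReal (C * Real.exp (-c) * Real.exp y) ∂(P.map W) := by
        refine lintegral_mono fun y => ?_
        have e : ((fun x : ℝ => (x, y)) ⁻¹' {p | c ≤ θ * p.1 + p.2})
            = {x | θ * ((c - y) / θ) ≤ θ * x} := by
          ext x
          simp only [Set.mem_preimage, Set.mem_ofPred_eq, mul_div_cancel₀ _ hθ]
          constructor <;> intro h <;> linarith
        rw [e]
        refine (htail _).trans (le_of_eq ?_)
        rw [mul_assoc, ← Real.exp_add]
        congr 3
        field_simp
        ring
    _ = ∫⁻ ω, ENNReal.ofReal (C * Real.exp (-c) * Real.exp (W ω)) ∂P :=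
        lintegral_map' (by fun_prop) hW
    _ = ENNReal.ofReal (C * Real.exp (-c) * mgf W P 1) := by
        rw [← ofReal_integral_eq_lintegral_ofReal (hint.const_mul _)
          (ae_of_all _ fun ω => by positivity), integral_const_mul]
        simp [mgf]

end Compose

/-! ### Gaussian projections of fixed vectors -/

section Projection

variable {V : Type*} [Fintype V] {q : ℕ}

/-- The dot products of the rows of a matrix, given by its entries, with a fixed vector. -/
noncomputable def rowDot (q : ℕ) (c : V → ℝ) : (Fin q × V → ℝ) →L[ℝ] (Fin q → ℝ) :=
  ContinuousLinearMap.pi fun i => ∑ w, c w • ContinuousLinearMap.proj (R := ℝ) (i, w)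

theorem rowDot_apply (c : V → ℝ) (x : Fin q × V → ℝ) (i : Fin q) :
    rowDot q c x i = ∑ w, x (i, w) * c w := by
  simp [rowDot, mul_comm]

variable {Ω : Type*} [MeasurableSpace Ω] {P : Measure Ω}
  {R : Ω → Matrix (Fin q) V ℝ}

theorem IsGaussianProjection.hasGaussianLaw (hR : IsGaussianProjection R P) :
    HasGaussianLaw (fun ω (p : Fin q × V) => R ω p.1 p.2) P :=
  hR.indep.hasGaussianLaw fun p => (hR.hasLaw p.1 p.2).hasGaussianLaw

theorem IsGaussianProjection.hasGaussianLaw_rows (hR : IsGaussianProjection R P) (c : V → ℝ) :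
    HasGaussianLaw (fun ω i => R ω i ⬝ᵥ c) P := by
  have e : (fun ω i => R ω i ⬝ᵥ c) = fun ω => rowDot q c fun p => R ω p.1 p.2 := by
    ext ω i
    simp [rowDot_apply, dotProduct]
  rw [e]
  exact hR.hasGaussianLaw.map_fun (rowDot q c)

theorem IsGaussianProjection.hasGaussianLaw_rows_prod (hR : IsGaussianProjection R P)
    (c d : V → ℝ) :
    HasGaussianLaw (fun ω => (fun i => R ω i ⬝ᵥ c, fun i => R ω i ⬝ᵥ d)) P := by
  have e : (fun ω => (fun i => R ω i ⬝ᵥ c, fun i => R ω i ⬝ᵥ d))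
      = fun ω => ((rowDot q c).prod (rowDot q d)) fun p => R ω p.1 p.2 := by
    ext ω i <;> simp [rowDot_apply, dotProduct]
  rw [e]
  exact hR.hasGaussianLaw.map_fun ((rowDot q c).prod (rowDot q d))

theorem IsGaussianProjection.covariance_rows (hR : IsGaussianProjection R P)
    (c d : V → ℝ) (i j : Fin q) :
    cov[fun ω => R ω i ⬝ᵥ c, fun ω => R ω j ⬝ᵥ d; P]
      = if i = j then (c ⬝ᵥ d) / q else 0 := by
  classical
  have := hR.indep.isProbabilityMeasure
  have hm : ∀ i w, MemLp (fun ω => R ω i w) 2 P := fun i w =>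
    (hR.hasLaw i w).hasGaussianLaw.memLp_two
  have hcov : ∀ w w', cov[fun ω => R ω i w, fun ω => R ω j w'; P]
      = if (i, w) = (j, w') then (q : ℝ)⁻¹ else 0 := by
    intro w w'
    split_ifs with h
    · obtain ⟨rfl, rfl⟩ := Prod.mk.inj h
      rw [covariance_self (hR.hasLaw i w).aemeasurable, (hR.hasLaw i w).variance_eq,
        variance_id_gaussianReal]
      simp
    · exact (hR.indep.indepFun h).covariance_eq_zero (hm i w) (hm j w')
  simp only [dotProduct]
  rw [covariance_fun_sum_fun_sum (fun w => (hm i w).mul_const (c w))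
    (fun w => (hm j w).mul_const (d w))]
  simp_rw [covariance_mul_const_left, covariance_mul_const_right, hcov]
  split_ifs with h
  · subst h
    simp only [Prod.mk.injEq, true_and, ite_mul, zero_mul, Finset.sum_ite_eq, Finset.mem_univ,
      if_true, Finset.sum_div]
    exact Finset.sum_congr rfl fun w _ => by ring
  · simp [h]

theorem IsGaussianProjection.hasLaw_row (hR : IsGaussianProjection R P) (c : V → ℝ) (i : Fin q) :
    HasLaw (fun ω => R ω i ⬝ᵥ c) (gaussianReal 0 ((c ⬝ᵥ c) / q).toNNReal) P := by
  have := hR.indep.isProbabilityMeasure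
  have h := (hR.hasGaussianLaw_rows c).eval i
  refine ⟨h.aemeasurable, ?_⟩
  rw [h.map_eq_gaussianReal]
  have hv : Var[fun ω => R ω i ⬝ᵥ c; P] = (c ⬝ᵥ c) / q := by
    rw [← covariance_self h.aemeasurable, hR.covariance_rows, if_pos rfl]
  have he : P[fun ω => R ω i ⬝ᵥ c] = 0 := by
    simp only [dotProduct]
    rw [integral_finsetSum _ fun w _ =>
      (hR.hasLaw i w).hasGaussianLaw.integrable.mul_const (c w)]
    refine Finset.sum_eq_zero fun w _ => ?_
    rw [integral_mul_const, (hR.hasLaw i w).integral_eq, integral_id_gaussianReal, zero_mul]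
  rw [hv, he]

theorem IsGaussianProjection.iIndepFun_rows (hR : IsGaussianProjection R P) (c : V → ℝ) :
    iIndepFun (fun i ω => R ω i ⬝ᵥ c) P :=
  (hR.hasGaussianLaw_rows c).iIndepFun_of_covariance_eq_zero fun i j hij => by
    rw [hR.covariance_rows, if_neg hij]

theorem IsGaussianProjection.indepFun_rows_of_orthogonal (hR : IsGaussianProjection R P)
    {c d : V → ℝ} (hcd : c ⬝ᵥ d = 0) :
    IndepFun (fun ω i => R ω i ⬝ᵥ c) (fun ω i => R ω i ⬝ᵥ d) P :=
  (hR.hasGaussianLaw_rows_prod c d).indepFun_of_covariance_eval fun i j => by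
    rw [hR.covariance_rows, hcd, zero_div, ite_self]

theorem mgf_sq_of_hasLaw_gaussianReal_var {Y : Ω → ℝ} {s : ℝ≥0}
    (hY : HasLaw Y (gaussianReal 0 s) P) (t : ℝ) :
    mgf (fun ω => Y ω ^ 2) P t = √((1 - 2 * (t * s))⁻¹) := by
  have h1 : mgf (fun ω => Y ω ^ 2) P t = ∫ x, Real.exp (t * x ^ 2) ∂(gaussianReal 0 s) :=
    hY.integral_comp (f := fun x => Real.exp (t * x ^ 2)) (by fun_prop)
  have h2 : gaussianReal 0 s = (gaussianReal 0 1).map (√(s : ℝ) * ·) := by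
    rw [gaussianReal_map_const_mul]
    congr 1
    · simp
    · ext; simp
  rw [h1, h2, integral_map (by fun_prop) (by fun_prop),
    ← mgf_sq_of_hasLaw_gaussianReal (HasLaw.id (μ := gaussianReal 0 1)), mgf]
  congr 1 with x
  rw [mul_pow, Real.sq_sqrt s.coe_nonneg]
  simp only [id_eq, mul_assoc]

/-- With m = q - 2, Stirling's main term for Γ(q/2) cancels the maximum of the tilted density,
leaving the factor 1/√(πm). -/
theorem gammaTailConstant_mul_le_exp_logTail (hq : 6 ≤ q) {l ρ ε : ℝ} (hl : l < 1 / 2)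
    (hl' : -1 < l) (hl0 : l ≠ 0) (h0 : 0 ≤ ρ) (h1 : ρ ≤ 1) :
    (1 / 2) ^ ((q : ℝ) / 2) / Real.Gamma (q / 2) * (((q : ℝ) / 2 - 1) / (Real.exp 1
        * (1 / 2 - l * (1 + ρ) / 2))) ^ ((q : ℝ) / 2 - 1) / |l * (1 + ρ) / 2|
      * Real.exp (-(q * (|l| * ε + l * ρ))) * (1 + l * (1 - ρ)) ^ (-(q : ℝ) / 2)
      ≤ Real.exp (logTail (q - 2) ε l ρ) := by
  have hq' : (6 : ℝ) ≤ q := by exact_mod_cast hq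
  have hA : 0 < 1 - l * (1 + ρ) := by nlinarith
  have hB : 0 < 1 + l * (1 - ρ) := by nlinarith
  have hG := Real.Gamma_pos_of_pos (by linarith : 0 < (q : ℝ) / 2)
  have hA' : 0 < 1 / 2 - l * (1 + ρ) / 2 := by linarith
  have hk : 0 < (q : ℝ) / 2 - 1 := by linarith
  have hlab : 0 < |l| := abs_pos.2 hl0
  have habs : |l * (1 + ρ) / 2| = |l| * (1 + ρ) / 2 := by
    rw [abs_div, abs_mul, abs_of_pos (by linarith : 0 < 1 + ρ), abs_two]
  have hg := log_Gamma_half_add_one_ge (n := q - 2) (by omega)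
  have hcast : ((q - 2 : ℕ) : ℝ) = q - 2 := by
    rw [Nat.cast_sub (by omega)]; norm_num
  rw [hcast, show ((q : ℝ) - 2) / 2 + 1 = q / 2 by ring,
    show ((q : ℝ) - 2) / 2 = q / 2 - 1 by ring] at hg
  rw [habs]
  set X := (1 / 2) ^ ((q : ℝ) / 2) / Real.Gamma (q / 2) * (((q : ℝ) / 2 - 1) / (Real.exp 1
        * (1 / 2 - l * (1 + ρ) / 2))) ^ ((q : ℝ) / 2 - 1) / (|l| * (1 + ρ) / 2)
      * Real.exp (-(q * (|l| * ε + l * ρ))) * (1 + l * (1 - ρ)) ^ (-(q : ℝ) / 2) with hX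
  have hXpos : 0 < X := by positivity
  rw [← Real.log_le_iff_le_exp hXpos, hX,
    Real.log_mul (by positivity) (by positivity), Real.log_mul (by positivity) (by positivity),
    Real.log_div (by positivity) (by positivity), Real.log_mul (by positivity) (by positivity),
    Real.log_div (by positivity) hG.ne', Real.log_rpow (by positivity),
    Real.log_rpow (by positivity), Real.log_rpow hB, Real.log_exp,
    Real.log_div hk.ne' (by positivity), Real.log_mul (by positivity) hA'.ne', Real.log_exp,
    Real.log_div (x := |l| * (1 + ρ)) (by positivity) (by norm_num),
    Real.log_mul hlab.ne' (by positivity),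
    show 1 / 2 - l * (1 + ρ) / 2 = (1 - l * (1 + ρ)) / 2 by ring,
    Real.log_div hA.ne' (by norm_num), Real.log_div (by norm_num) (by norm_num), Real.log_one,
    logTail]
  rw [sub_add_cancel, show ((q : ℝ) - 2) / 2 = q / 2 - 1 by ring]
  linarith

theorem IsGaussianProjection.mgf_sum_sq_rows (hR : IsGaussianProjection R P) (c : V → ℝ) (t : ℝ) :
    mgf (fun ω => ∑ i, (R ω i ⬝ᵥ c) ^ 2) P t = √((1 - 2 * (t * ((c ⬝ᵥ c) / q)))⁻¹) ^ q := by
  have hi := (hR.iIndepFun_rows c).comp (fun _ x => x ^ 2) (fun _ => by fun_prop)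
  have e : (fun ω => ∑ i, (R ω i ⬝ᵥ c) ^ 2)
      = ∑ i, ((fun x : ℝ => x ^ 2) ∘ fun ω => R ω i ⬝ᵥ c) := by
    ext ω; simp
  rw [e, hi.mgf_sum₀ fun i => (hR.hasLaw_row c i).aemeasurable.pow_const 2]
  have : ∀ i, mgf ((fun x : ℝ => x ^ 2) ∘ fun ω => R ω i ⬝ᵥ c) P t
      = √((1 - 2 * (t * ((c ⬝ᵥ c) / q)))⁻¹) := fun i => by
    have h := mgf_sq_of_hasLaw_gaussianReal_var (hR.hasLaw_row c i) t
    have hc : 0 ≤ c ⬝ᵥ c := Finset.sum_nonneg fun w _ => mul_self_nonneg _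
    rwa [Real.coe_toNNReal _ (by positivity)] at h
  simp_rw [this]
  simp

theorem IsGaussianProjection.hasLaw_sum_sq_rows (hR : IsGaussianProjection R P) (hq : 0 < q)
    {c : V → ℝ} (hc : 0 < c ⬝ᵥ c) :
    HasLaw (fun ω => q / (c ⬝ᵥ c) * ∑ i, (R ω i ⬝ᵥ c) ^ 2) (gammaMeasure (q / 2) (1 / 2)) P := by
  have hq' : (0 : ℝ) < q := by exact_mod_cast hq
  set s := √(q / (c ⬝ᵥ c)) with hs
  have h1 : ∀ i, HasLaw (fun ω => s * (R ω i ⬝ᵥ c)) (gaussianReal 0 1) P := fun i => by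
    have h := gaussianReal_const_mul (hR.hasLaw_row c i) s
    convert h using 1
    rw [mul_zero]
    congr 1
    ext
    simp only [NNReal.coe_one, NNReal.coe_mul, NNReal.coe_mk]
    rw [Real.coe_toNNReal _ (by positivity), hs, Real.sq_sqrt (by positivity)]
    field_simp
  have h2 : iIndepFun (fun i ω => s * (R ω i ⬝ᵥ c)) P :=
    (hR.iIndepFun_rows c).comp (fun _ x => s * x) (fun _ => by fun_prop)
  have h3 := hasLaw_sum_sq_gammaMeasure hq h1 h2
  convert h3 using 2 with ω
  rw [Finset.mul_sum]
  refine Finset.sum_congr rfl fun i _ => ?_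
  rw [mul_pow, hs, Real.sq_sqrt (by positivity)]

/-- The sign of l selects the tail. The density bound goes to a + b, which cannot vanish as ρ ≥ 0; a
- b may be 0, so only its mgf is used. -/
theorem IsGaussianProjection.unit_tail_le (hR : IsGaussianProjection R P) (hq : 6 ≤ q)
    {a b : V → ℝ} (ha : a ⬝ᵥ a = 1) (hb : b ⬝ᵥ b = 1) (h0 : 0 ≤ a ⬝ᵥ b) (h1 : a ⬝ᵥ b ≤ 1)
    {l ε : ℝ} (hl : l < 1 / 2) (hl' : -1 < l) (hl0 : l ≠ 0) :
    P {ω | |l| * ε ≤ l * (∑ i, (R ω i ⬝ᵥ a) * (R ω i ⬝ᵥ b) - a ⬝ᵥ b)}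
      ≤ ENNReal.ofReal (Real.exp (logTail (q - 2) ε l (a ⬝ᵥ b))) := by
  have := hR.indep.isProbabilityMeasure
  have hq0 : 0 < q := by omega
  have hq' : (6 : ℝ) ≤ q := by exact_mod_cast hq
  set ρ := a ⬝ᵥ b with hρ
  have hba : b ⬝ᵥ a = ρ := dotProduct_comm b a
  have hpp : (a + b) ⬝ᵥ (a + b) = 2 * (1 + ρ) := by
    simp only [add_dotProduct, dotProduct_add, ha, hb, hba, ← hρ]; ring
  have hmm : (a - b) ⬝ᵥ (a - b) = 2 * (1 - ρ) := by
    simp only [sub_dotProduct, dotProduct_sub, ha, hb, hba, ← hρ]; ring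
  have hpm : (a + b) ⬝ᵥ (a - b) = 0 := by
    simp only [add_dotProduct, dotProduct_sub, ha, hb, hba, ← hρ]; ring
  have hA : 0 < 1 - l * (1 + ρ) := by nlinarith
  have hB : 0 < 1 + l * (1 - ρ) := by nlinarith
  set X : Ω → ℝ := fun ω => q / ((a + b) ⬝ᵥ (a + b)) * ∑ i, (R ω i ⬝ᵥ (a + b)) ^ 2 with hX
  set Z : Ω → ℝ := fun ω => ∑ i, (R ω i ⬝ᵥ (a - b)) ^ 2 with hZ
  set W : Ω → ℝ := fun ω => -(l * q / 4) * Z ω with hW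
  set θ := l * (1 + ρ) / 2 with hθ
  have hθ0 : θ ≠ 0 := by
    have : 1 + ρ ≠ 0 := by linarith
    positivity
  have hXlaw : HasLaw X (gammaMeasure (q / 2) (1 / 2)) P :=
    hR.hasLaw_sum_sq_rows hq0 (by rw [hpp]; linarith)
  have hZm : AEMeasurable Z P :=
    Finset.aemeasurable_fun_sum _ fun i _ => (hR.hasLaw_row (a - b) i).aemeasurable.pow_const 2
  have hWm : AEMeasurable W P := hZm.const_mul _
  have hind : IndepFun X W P := by
    have h := (hR.indepFun_rows_of_orthogonal hpm).comp
      (φ := fun x : Fin q → ℝ => q / ((a + b) ⬝ᵥ (a + b)) * ∑ i, x i ^ 2)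
      (ψ := fun x : Fin q → ℝ => -(l * q / 4) * ∑ i, x i ^ 2) (by fun_prop) (by fun_prop)
    exact h
  have hmgf : mgf W P 1 = (1 + l * (1 - ρ)) ^ (-(q : ℝ) / 2) := by
    have e : mgf W P 1 = mgf Z P (-(l * q / 4)) := by
      simp [mgf, hW]
    rw [e, hZ, hR.mgf_sum_sq_rows, hmm]
    have : 1 - 2 * (-(l * q / 4) * (2 * (1 - ρ) / q)) = 1 + l * (1 - ρ) := by
      field_simp; ring
    rw [this, Real.sqrt_eq_rpow, ← Real.rpow_natCast, ← Real.rpow_mul (by positivity),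
      Real.inv_rpow hB.le, ← Real.rpow_neg hB.le]
    ring_nf
  have hint : Integrable (fun ω => Real.exp (W ω)) P := by
    have h : 0 < mgf W P 1 := by rw [hmgf]; positivity
    simpa using mgf_pos_iff.1 h
  have hG := Real.Gamma_pos_of_pos (by linarith : 0 < (q : ℝ) / 2)
  have hk : 0 < (q : ℝ) / 2 - 1 := by linarith
  have hr : 0 < 1 / 2 - θ := by rw [hθ]; linarith
  have key := measure_le_add_le_of_indepFun hXlaw.aemeasurable hWm hind
    (C := (1 / 2) ^ ((q : ℝ) / 2) / Real.Gamma (q / 2) * (((q : ℝ) / 2 - 1) / (Real.exp 1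
        * (1 / 2 - θ))) ^ ((q : ℝ) / 2 - 1) / |θ|) (θ := θ) (by positivity)
    (fun x₀ => by
      rw [hXlaw.map_eq]
      refine (gammaMeasure_tail_le (by linarith) (by linarith) hθ0 x₀).trans (le_of_eq ?_)
      congr 1
      ring) hθ0 (q * (|l| * ε + l * ρ)) hint
  rw [hmgf] at key
  refine le_trans (le_of_eq ?_) (key.trans (ENNReal.ofReal_le_ofReal
    (gammaTailConstant_mul_le_exp_logTail hq hl hl' hl0 h0 h1)))
  congr 1
  ext ω
  have hS : ∑ i, (R ω i ⬝ᵥ a) * (R ω i ⬝ᵥ b)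
      = (∑ i, (R ω i ⬝ᵥ (a + b)) ^ 2 - ∑ i, (R ω i ⬝ᵥ (a - b)) ^ 2) / 4 := by
    rw [← Finset.sum_sub_distrib, Finset.sum_div]
    refine Finset.sum_congr rfl fun i _ => ?_
    rw [dotProduct_add, dotProduct_sub]
    ring
  have hsum : θ * X ω + W ω = q * (l * ∑ i, (R ω i ⬝ᵥ a) * (R ω i ⬝ᵥ b)) := by
    have : 1 + ρ ≠ 0 := by linarith
    rw [hS, hW, hX, hZ, hθ]
    simp only [hpp]
    field_simp
    ring
  simp only [Set.mem_ofPred_eq, hsum]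
  rw [mul_le_mul_iff_right₀ (by linarith : (0 : ℝ) < q)]
  constructor <;> intro h <;> linarith

theorem IsGaussianProjection.unit_deviation_le (hR : IsGaussianProjection R P) (hq : 6 ≤ q)
    {a b : V → ℝ} (ha : a ⬝ᵥ a = 1) (hb : b ⬝ᵥ b = 1) (h0 : 0 ≤ a ⬝ᵥ b) (h1 : a ⬝ᵥ b ≤ 1)
    {ε : ℝ} (hε : 0 < ε) (hε1 : ε < 1) (hL : Real.log 2 ≤ q * ε ^ 2 / (4 * (1 + ε))) :
    P {ω | ε ≤ |∑ i, (R ω i ⬝ᵥ a) * (R ω i ⬝ᵥ b) - a ⬝ᵥ b|}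
      ≤ ENNReal.ofReal (2 / 3 * Real.exp (-(q * ε ^ 2 / (4 * (1 + ε))))) := by
  have hq' : (6 : ℝ) ≤ q := by exact_mod_cast hq
  have hm : (q : ℝ) - 2 + 2 = q := by ring
  obtain ⟨⟨l, hl0, hl1, hl⟩, ⟨l', hl0', hl1', hl'⟩⟩ :=
    exists_logTail_le (m := (q : ℝ) - 2) hε hε1 (by linarith) (by rwa [hm])
  have e : Real.exp (-Real.log 3 - (q - 2 + 2) * ε ^ 2 / (4 * (1 + ε)))
      = 1 / 3 * Real.exp (-(q * ε ^ 2 / (4 * (1 + ε)))) := by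
    rw [hm, sub_eq_add_neg, Real.exp_add, Real.exp_neg, Real.exp_log (by norm_num), one_div]
  have k1 := (hR.unit_tail_le hq ha hb h0 h1 hl1 (by linarith) hl0.ne' (ε := ε)).trans
    (ENNReal.ofReal_le_ofReal (Real.exp_le_exp.2 (hl _ h0 h1)))
  have k2 := (hR.unit_tail_le hq ha hb h0 h1 (by linarith) hl0' hl1'.ne (ε := ε)).trans
    (ENNReal.ofReal_le_ofReal (Real.exp_le_exp.2 (hl' _ h0 h1)))
  rw [e] at k1 k2
  have e2 : 2 / 3 * Real.exp (-(q * ε ^ 2 / (4 * (1 + ε))))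
      = 1 / 3 * Real.exp (-(q * ε ^ 2 / (4 * (1 + ε))))
        + 1 / 3 * Real.exp (-(q * ε ^ 2 / (4 * (1 + ε)))) := by ring
  rw [e2, ENNReal.ofReal_add (by positivity) (by positivity)]
  refine le_trans (measure_mono fun ω hω => ?_) ((measure_union_le _ _).trans (add_le_add k1 k2))
  rcases le_abs.1 (show ε ≤ |_| from hω) with h | h
  · left
    change |l| * ε ≤ l * _
    rw [abs_of_pos hl0]
    gcongr
  · right
    change |l'| * ε ≤ l' * _
    rw [abs_of_neg hl1']
    nlinarith

end Projection

/-! ### Fourth moments and the central limit theorem -/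

theorem integral_pow_four_of_hasLaw_gaussianReal {Ω : Type*} [MeasurableSpace Ω] {P : Measure Ω}
    {Y : Ω → ℝ} {v : ℝ≥0} (hY : HasLaw Y (gaussianReal 0 v) P) :
    ∫ ω, Y ω ^ 4 ∂P = 3 * (v : ℝ) ^ 2 := by
  have h1 : ∫ ω, Y ω ^ 4 ∂P = ∫ x, x ^ 4 ∂(gaussianReal 0 v) :=
    hY.integral_comp (f := fun x => x ^ 4) (by fun_prop)
  have h2 := iteratedDeriv_mgf_zero (X := id) (μ := gaussianReal 0 v) (by simp) 4
  have h2' : iteratedDeriv 4 (mgf id (gaussianReal 0 v)) 0 = ∫ x, x ^ 4 ∂(gaussianReal 0 v) := h2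
  have e0 : mgf id (gaussianReal 0 v) = fun t => 1 * Real.exp (v * t ^ 2 / 2) := by
    rw [mgf_id_gaussianReal]; simp
  have hd (t : ℝ) : HasDerivAt (fun t => Real.exp (v * t ^ 2 / 2))
      (Real.exp (v * t ^ 2 / 2) * (v * t)) t := by
    refine ((((hasDerivAt_pow 2 t).const_mul (v : ℝ)).div_const 2).exp).congr_deriv ?_
    simp only [Nat.cast_ofNat, Nat.add_one_sub_one, pow_one]
    ring
  -- Every derivative of the mgf is a polynomial times e^{vt²/2}; differentiation sends p to p' +
  -- vtp.
  have step (p p' r : ℝ → ℝ) (hp : ∀ t, HasDerivAt p (p' t) t)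
      (hr : ∀ t, p' t + p t * (v * t) = r t) :
      deriv (fun t => p t * Real.exp (v * t ^ 2 / 2))
        = fun t => r t * Real.exp (v * t ^ 2 / 2) := by
    ext t
    refine (((hp t).mul (hd t)).congr_deriv ?_).deriv
    rw [← hr]
    ring
  have hid (b t : ℝ) : HasDerivAt (fun t => b * t) b t := by
    simpa using (hasDerivAt_id t).const_mul b
  rw [h1, ← h2', e0, iteratedDeriv_succ',
    step _ (fun _ => 0) (fun t => v * t) (fun t => hasDerivAt_const t 1) (fun t => by ring),
    iteratedDeriv_succ',
    step _ (fun _ => v) (fun t => v + v ^ 2 * t ^ 2) (hid _) (fun t => by ring),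
    iteratedDeriv_succ',
    step _ (fun t => v ^ 2 * (2 * t)) (fun t => 3 * v ^ 2 * t + v ^ 3 * t ^ 3)
      (fun t => by simpa using ((hasDerivAt_pow 2 t).const_mul ((v : ℝ) ^ 2)).const_add (v : ℝ))
      (fun t => by ring),
    iteratedDeriv_succ', iteratedDeriv_zero,
    step (fun t => 3 * v ^ 2 * t + v ^ 3 * t ^ 3) (fun t => 3 * v ^ 2 + v ^ 3 * (3 * t ^ 2))
      (fun t => 3 * v ^ 2 + v ^ 3 * (3 * t ^ 2) + (3 * v ^ 2 * t + v ^ 3 * t ^ 3) * (v * t))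
      (fun t => (hid (3 * (v : ℝ) ^ 2) t).add
        ((hasDerivAt_pow 3 t).const_mul ((v : ℝ) ^ 3)))
      (fun t => rfl)]
  simp

section Projection

variable {V : Type*} [Fintype V] {q : ℕ}
variable {Ω : Type*} [MeasurableSpace Ω] {P : Measure Ω}
  {R : Ω → Matrix (Fin q) V ℝ}

theorem IsGaussianProjection.iIndepFun_row (hR : IsGaussianProjection R P) :
    iIndepFun (fun i ω => R ω i) P := by
  have hc : HasGaussianLaw (fun ω i w => R ω i w) P := by
    let L : (Fin q × V → ℝ) →L[ℝ] (Fin q → V → ℝ) :=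
      ContinuousLinearMap.pi fun i => ContinuousLinearMap.pi fun w =>
        ContinuousLinearMap.proj (R := ℝ) (i, w)
    exact hR.hasGaussianLaw.map_fun L
  have hm : ∀ i w, MemLp (fun ω => R ω i w) 2 P := fun i w =>
    (hR.hasLaw i w).hasGaussianLaw.memLp_two
  have := hR.indep.isProbabilityMeasure
  exact HasGaussianLaw.iIndepFun_of_covariance_eval (X := fun i w ω => R ω i w) hc
    fun i j hij k l => (hR.indep.indepFun (i := (i, k)) (j := (j, l))
      (by simp [hij])).covariance_eq_zero (hm i k) (hm j l)

theorem IsGaussianProjection.hasLaw_sqrt_smul_row (hR : IsGaussianProjection R P) (i : Fin q) :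
    HasLaw (fun ω => √(q : ℝ) • R ω i) (Measure.pi fun _ : V => gaussianReal 0 1) P := by
  have hq : (0 : ℝ) < q := by exact_mod_cast i.pos
  have h1 : ∀ w, HasLaw (fun ω => √(q : ℝ) * R ω i w) (gaussianReal 0 1) P := fun w => by
    have h := gaussianReal_const_mul (hR.hasLaw i w) √(q : ℝ)
    convert h using 1
    rw [mul_zero]
    congr 1
    ext
    simp [Real.sq_sqrt hq.le, hq.ne']
  have h2 : iIndepFun (fun w ω => √(q : ℝ) * R ω i w) P :=
    (hR.indep.precomp (g := fun w => (i, w)) (Prod.mk_right_injective i)).comp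
      (fun _ x => √(q : ℝ) * x) (fun _ => by fun_prop)
  refine ⟨aemeasurable_pi_lambda _ fun w => (h1 w).aemeasurable, ?_⟩
  have h3 := h2.map_fun_eq_pi_map fun w => (h1 w).aemeasurable
  simp_rw [(h1 _).map_eq] at h3
  exact h3

theorem IsGaussianProjection.integral_row_mul_row (hR : IsGaussianProjection R P)
    (c d : V → ℝ) (i : Fin q) :
    ∫ ω, (R ω i ⬝ᵥ c) * (R ω i ⬝ᵥ d) ∂P = (c ⬝ᵥ d) / q := by
  have := hR.indep.isProbabilityMeasure
  have hm : ∀ c, MemLp (fun ω => R ω i ⬝ᵥ c) 2 P := fun c =>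
    ((hR.hasGaussianLaw_rows c).eval i).memLp_two
  have h := hR.covariance_rows c d i i
  have h0 : ∫ ω, R ω i ⬝ᵥ c ∂P = 0 := by
    rw [(hR.hasLaw_row c i).integral_eq, integral_id_gaussianReal]
  rw [covariance_eq_sub (hm c) (hm d), h0, zero_mul, sub_zero, if_pos rfl] at h
  exact h

theorem IsGaussianProjection.integral_row_mul_row_sq (hR : IsGaussianProjection R P)
    (c d : V → ℝ) (i : Fin q) :
    ∫ ω, ((R ω i ⬝ᵥ c) * (R ω i ⬝ᵥ d)) ^ 2 ∂P
      = ((c ⬝ᵥ c) * (d ⬝ᵥ d) + 2 * (c ⬝ᵥ d) ^ 2) / q ^ 2 := by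
  have h4 : ∀ c, ∫ ω, (R ω i ⬝ᵥ c) ^ 4 ∂P = 3 * ((c ⬝ᵥ c) / q) ^ 2 := fun c => by
    have hc : 0 ≤ c ⬝ᵥ c := Finset.sum_nonneg fun w _ => mul_self_nonneg _
    rw [integral_pow_four_of_hasLaw_gaussianReal (hR.hasLaw_row c i),
      Real.coe_toNNReal _ (by positivity)]
  have hi : ∀ c, Integrable (fun ω => (R ω i ⬝ᵥ c) ^ 4) P := fun c => by
    have := ((hR.hasGaussianLaw_rows c).eval i).memLp (p := 4) (by simp)
    simpa [(show Even 4 by decide).pow_abs] using this.integrable_norm_pow (by norm_num)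
  -- Polarization: 12x²y² = (x+y)⁴ + (x-y)⁴ - 2x⁴ - 2y⁴.
  have e : ∀ ω, ((R ω i ⬝ᵥ c) * (R ω i ⬝ᵥ d)) ^ 2
      = ((R ω i ⬝ᵥ (c + d)) ^ 4 + (R ω i ⬝ᵥ (c - d)) ^ 4
        - 2 * (R ω i ⬝ᵥ c) ^ 4 - 2 * (R ω i ⬝ᵥ d) ^ 4) / 12 := fun ω => by
    rw [dotProduct_add, dotProduct_sub]; ring
  simp_rw [e]
  have hs : Integrable (fun ω => (R ω i ⬝ᵥ (c + d)) ^ 4 + (R ω i ⬝ᵥ (c - d)) ^ 4) P :=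
    (hi _).add (hi _)
  have hs' : Integrable (fun ω => (R ω i ⬝ᵥ (c + d)) ^ 4 + (R ω i ⬝ᵥ (c - d)) ^ 4
      - 2 * (R ω i ⬝ᵥ c) ^ 4) P := hs.sub ((hi _).const_mul 2)
  rw [integral_div, integral_sub hs' ((hi _).const_mul 2), integral_sub hs ((hi _).const_mul 2),
    integral_add (hi _) (hi _), integral_const_mul, integral_const_mul, h4, h4, h4, h4]
  simp only [add_dotProduct, sub_dotProduct, dotProduct_add, dotProduct_sub, dotProduct_comm d c]
  ring

end Projection

theorem asymptoticallyNormal_sum_row_mul_row {V : Type*} [Fintype V] {Ω : ℕ → Type*}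
    [∀ q, MeasurableSpace (Ω q)] (P : ∀ q, Measure (Ω q)) [∀ q, IsProbabilityMeasure (P q)]
    (R : ∀ q, Ω q → Matrix (Fin q) V ℝ) (hR : ∀ q, IsGaussianProjection (R q) (P q))
    {c d : V → ℝ} (hc : 0 < c ⬝ᵥ c) (hd : 0 < d ⬝ᵥ d) :
    AsymptoticallyNormal P (fun q ω => ∑ i, (R q ω i ⬝ᵥ c) * (R q ω i ⬝ᵥ d)) (c ⬝ᵥ d)
      ((c ⬝ᵥ c) * (d ⬝ᵥ d) + (c ⬝ᵥ d) ^ 2) := by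
  set v := (c ⬝ᵥ c) * (d ⬝ᵥ d) + (c ⬝ᵥ d) ^ 2 with hv
  have hv0 : 0 < v := by positivity
  have hsum (q : ℕ) : AEMeasurable
      (fun ω => ∑ i, (R q ω i ⬝ᵥ c) * (R q ω i ⬝ᵥ d)) (P q) :=
    Finset.aemeasurable_fun_sum _ fun i _ =>
      ((hR q).hasLaw_row c i).aemeasurable.mul ((hR q).hasLaw_row d i).aemeasurable
  set g : (V → ℝ) → ℝ := fun x => ((x ⬝ᵥ c) * (x ⬝ᵥ d) - c ⬝ᵥ d) / √v with hg
  have hgm : Measurable g := by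
    simp only [hg, dotProduct]
    fun_prop
  -- The space for q = 1 carries a reference copy of one standardized summand, with the same law as
  -- every summand for every q.
  set Z : Ω 1 → ℝ := fun ω => g (R 1 ω 0) with hZ
  have hlaw (q : ℕ) (i : Fin q) :
      (P q).map (fun ω => g (√(q : ℝ) • R q ω i)) = (P 1).map Z := by
    have h1 := (hR q).hasLaw_sqrt_smul_row i
    have h2 := (hR 1).hasLaw_sqrt_smul_row 0
    have h : IdentDistrib (fun ω => √(q : ℝ) • R q ω i) (fun ω => √((1 : ℕ) : ℝ) • R 1 ω 0)
      (P q) (P 1) := ⟨h1.aemeasurable, h2.aemeasurable, h1.map_eq.trans h2.map_eq.symm⟩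
    have := (h.comp hgm).map_eq
    simpa [Function.comp_def, hZ] using this
  have hprod : ∀ {c d : V → ℝ}, Integrable (fun ω => (R 1 ω 0 ⬝ᵥ c) * (R 1 ω 0 ⬝ᵥ d)) (P 1) :=
    fun {c d} => (((hR 1).hasGaussianLaw_rows c).eval 0).memLp_two.integrable_mul
      (((hR 1).hasGaussianLaw_rows d).eval 0).memLp_two
  have hprod2 : Integrable (fun ω => ((R 1 ω 0 ⬝ᵥ c) * (R 1 ω 0 ⬝ᵥ d)) ^ 2) (P 1) := by
    -- A non-integrable function has integral 0, so the nonzero value already computed proves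
    -- integrability.
    refine Integrable.of_integral_ne_zero ?_
    rw [(hR 1).integral_row_mul_row_sq]
    have := hv0
    rw [hv] at this
    have : 0 < (c ⬝ᵥ c) * (d ⬝ᵥ d) + 2 * (c ⬝ᵥ d) ^ 2 := by positivity
    simpa using this.ne'
  have hZm : AEMeasurable Z (P 1) := by
    have h := ((hR 1).hasLaw_sqrt_smul_row 0).aemeasurable
    simp only [Nat.cast_one, Real.sqrt_one, one_smul] at h
    exact hgm.comp_aemeasurable h
  have hZ0 : ∫ ω, Z ω ∂(P 1) = 0 := by
    simp only [hZ, hg]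
    rw [integral_div, integral_sub hprod (integrable_const _), (hR 1).integral_row_mul_row]
    simp
  have hZ1 : ∫ ω, (Z ^ 2) ω ∂(P 1) = 1 := by
    have e : ∀ ω, (Z ^ 2) ω = (((R 1 ω 0 ⬝ᵥ c) * (R 1 ω 0 ⬝ᵥ d)) ^ 2
        - 2 * (c ⬝ᵥ d) * ((R 1 ω 0 ⬝ᵥ c) * (R 1 ω 0 ⬝ᵥ d)) + (c ⬝ᵥ d) ^ 2) / v := fun ω => by
      simp only [hZ, hg, Pi.pow_apply, div_pow, Real.sq_sqrt hv0.le]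
      ring
    simp_rw [e]
    have hs : Integrable (fun ω => ((R 1 ω 0 ⬝ᵥ c) * (R 1 ω 0 ⬝ᵥ d)) ^ 2
        - 2 * (c ⬝ᵥ d) * ((R 1 ω 0 ⬝ᵥ c) * (R 1 ω 0 ⬝ᵥ d))) (P 1) := hprod2.sub (hprod.const_mul _)
    rw [integral_div, integral_add hs (integrable_const _),
      integral_sub hprod2 (hprod.const_mul _), integral_const_mul, (hR 1).integral_row_mul_row,
      (hR 1).integral_row_mul_row_sq, integral_const, div_eq_one_iff_eq hv0.ne', hv]
    simp
    ring
  have key (q : ℕ) (hq : 1 ≤ q) (t : ℝ) :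
      charFun ((P q).map
          (fun ω => (∑ i, (R q ω i ⬝ᵥ c) * (R q ω i ⬝ᵥ d) - c ⬝ᵥ d) / √v * √(q : ℝ))) t
        = charFun ((P 1).map Z) ((√(q : ℝ))⁻¹ * t) ^ q := by
    have hq' : (0 : ℝ) < q := by exact_mod_cast hq
    have e : (fun ω => (∑ i, (R q ω i ⬝ᵥ c) * (R q ω i ⬝ᵥ d) - c ⬝ᵥ d) / √v * √(q : ℝ))
        = fun ω => (√(q : ℝ))⁻¹ * ∑ i, g (√(q : ℝ) • R q ω i) := by
      ext ω
      simp only [hg, smul_dotProduct, smul_eq_mul]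
      rw [← Finset.sum_div, Finset.sum_sub_distrib]
      have : ∀ i, √(q : ℝ) * (R q ω i ⬝ᵥ c) * (√(q : ℝ) * (R q ω i ⬝ᵥ d))
          = q * ((R q ω i ⬝ᵥ c) * (R q ω i ⬝ᵥ d)) := fun i => by
        rw [mul_mul_mul_comm, Real.mul_self_sqrt hq'.le]
      simp_rw [this]
      rw [← Finset.mul_sum]
      have h2 : √(q : ℝ) ^ 2 = q := Real.sq_sqrt hq'.le
      have h3 : √(q : ℝ) ≠ 0 := (Real.sqrt_pos.2 hq').ne'
      simp only [Finset.sum_const, Finset.card_univ, Fintype.card_fin, nsmul_eq_mul]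
      field_simp
      rw [h2]
    have hm : ∀ i, AEMeasurable (fun ω => g (√(q : ℝ) • R q ω i)) (P q) := fun i =>
      hgm.comp_aemeasurable ((hR q).hasLaw_sqrt_smul_row i).aemeasurable
    have hi : iIndepFun (fun i ω => g (√(q : ℝ) • R q ω i)) (P q) :=
      (hR q).iIndepFun_row.comp (fun _ x => g (√(q : ℝ) • x)) fun _ => by fun_prop
    rw [e, charFun_map_mul_comp (Finset.aemeasurable_fun_sum _ fun i _ => hm i),
      hi.charFun_map_fun_sum_eq_prod hm]
    simp [hlaw]
  refine ⟨hv0, ⟨fun q => (((hsum q).sub_const _).div_const _).mul_const _, aemeasurable_id, ?_⟩⟩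
  refine ProbabilityMeasure.tendsto_iff_tendsto_charFun.2 fun t => ?_
  have h := tendsto_charFun_inv_sqrt_mul_pow hZm hZ0 hZ1 t
  simp only [ProbabilityMeasure.coe_mk, Measure.map_id, charFun_gaussianReal]
  refine Tendsto.congr' ((eventually_ge_atTop 1).mono fun q hq => (key q hq t).symm) ?_
  simpa [neg_div] using h

/-! ### Deviation for general vectors, union bound and the embedding -/

section Deviation

variable {V : Type*} [Fintype V] {q : ℕ} {Ω : Type*} [MeasurableSpace Ω] {P : Measure Ω}
  {R : Ω → Matrix (Fin q) V ℝ}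

theorem IsGaussianProjection.deviation_le (hR : IsGaussianProjection R P) (hq : 6 ≤ q)
    {c d : V → ℝ} (hc : 0 < c ⬝ᵥ c) (hd : 0 < d ⬝ᵥ d) (hcd : 0 ≤ c ⬝ᵥ d)
    {ε : ℝ} (hε : 0 < ε) (hε1 : ε < 1) (hL : Real.log 2 ≤ q * ε ^ 2 / (4 * (1 + ε))) :
    P {ω | ε * √((c ⬝ᵥ c) * (d ⬝ᵥ d)) ≤ |∑ i, (R ω i ⬝ᵥ c) * (R ω i ⬝ᵥ d) - c ⬝ᵥ d|}
      ≤ ENNReal.ofReal (2 / 3 * Real.exp (-(q * ε ^ 2 / (4 * (1 + ε))))) := by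
  have hr : 0 < √(c ⬝ᵥ c) := Real.sqrt_pos.2 hc
  have hs : 0 < √(d ⬝ᵥ d) := Real.sqrt_pos.2 hd
  have hrr := Real.mul_self_sqrt hc.le
  have hss := Real.mul_self_sqrt hd.le
  set r := √(c ⬝ᵥ c)
  set s := √(d ⬝ᵥ d)
  have h1 : c ⬝ᵥ d ≤ r * s := by
    have h := Finset.sum_mul_sq_le_sq_mul_sq Finset.univ c d
    have e : ∀ x : V → ℝ, ∑ i, x i ^ 2 = x ⬝ᵥ x := fun x => by simp [dotProduct, sq]
    rw [e, e] at h
    refine le_of_sq_le_sq ?_ (by positivity)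
    rw [mul_pow, sq r, sq s, hrr, hss]
    exact h
  have ha : (r⁻¹ • c) ⬝ᵥ (r⁻¹ • c) = 1 := by
    simp only [smul_dotProduct, dotProduct_smul, smul_eq_mul, ← hrr]
    field_simp
  have hb : (s⁻¹ • d) ⬝ᵥ (s⁻¹ • d) = 1 := by
    simp only [smul_dotProduct, dotProduct_smul, smul_eq_mul, ← hss]
    field_simp
  have hab : (r⁻¹ • c) ⬝ᵥ (s⁻¹ • d) = (c ⬝ᵥ d) / (r * s) := by
    simp only [smul_dotProduct, dotProduct_smul, smul_eq_mul]
    field_simp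
  refine le_trans (measure_mono fun ω hω => ?_) (hR.unit_deviation_le hq ha hb
    (by rw [hab]; positivity) (by rw [hab]; exact div_le_one_of_le₀ h1 (by positivity)) hε hε1 hL)
  have e : ∑ i, (R ω i ⬝ᵥ r⁻¹ • c) * (R ω i ⬝ᵥ s⁻¹ • d)
      = (∑ i, (R ω i ⬝ᵥ c) * (R ω i ⬝ᵥ d)) / (r * s) := by
    rw [Finset.sum_div]
    refine Finset.sum_congr rfl fun i _ => ?_
    simp only [dotProduct_smul, smul_eq_mul]
    field_simp
  have hω' : ε * (r * s) ≤ |∑ i, (R ω i ⬝ᵥ c) * (R ω i ⬝ᵥ d) - c ⬝ᵥ d| := by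
    rw [← Real.sqrt_mul hc.le]
    exact hω
  change ε ≤ |_|
  rw [e, hab, ← sub_div, abs_div, abs_of_pos (by positivity : 0 < r * s)]
  exact (le_div_iff₀ (by positivity)).2 hω'

end Deviation

/-- A symmetric family of events indexed by pairs, each of measure at most `p`, has a union of
measure at most `n (n + 1) / 2 * p`. -/
theorem measure_iUnion_symmetric_le {V Ω : Type*} [Fintype V] [MeasurableSpace Ω] (P : Measure Ω)
    (B : V → V → Set Ω) (hB : ∀ u v, B u v = B v u) {p : ℝ}
    (h : ∀ u v, P (B u v) ≤ ENNReal.ofReal p) :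
    P (⋃ u, ⋃ v, B u v)
      ≤ ENNReal.ofReal ((Fintype.card V : ℝ) * (Fintype.card V + 1) / 2 * p) := by
  classical
  have e : (⋃ u, ⋃ v, B u v) = ⋃ z ∈ (Finset.univ : Finset (Sym2 V)), Sym2.lift ⟨B, hB⟩ z := by
    ext ω
    simp only [Set.mem_iUnion, Finset.mem_univ, exists_prop, true_and]
    constructor
    · rintro ⟨u, v, h⟩
      exact ⟨s(u, v), h⟩
    · rintro ⟨z, hz⟩
      induction z with | _ u v => exact ⟨u, v, hz⟩
  have hcard : ((Finset.univ : Finset (Sym2 V)).card : ℝ)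
      = (Fintype.card V : ℝ) * (Fintype.card V + 1) / 2 := by
    rw [Finset.card_univ, Sym2.card, Nat.choose_two_right, Nat.add_sub_cancel]
    rw [Nat.cast_div (by rw [mul_comm]; exact (Nat.even_mul_succ_self _).two_dvd) (by norm_num)]
    push_cast
    ring
  rw [e, ← hcard]
  refine (measure_biUnion_finset_le _ _).trans ((Finset.sum_le_card_nsmul _ _ (ENNReal.ofReal p)
    (fun z _ => ?_)).trans (le_of_eq ?_))
  · induction z with | _ u v => exact h u v
  · rw [nsmul_eq_mul, ENNReal.ofReal_mul (by positivity), ENNReal.ofReal_natCast]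

section Embedding

variable {V : Type*} [Fintype V] (A : Matrix V V ℕ)

theorem transitionMatrix_dotProduct (u v : V) :
    transitionMatrix A u ⬝ᵥ transitionMatrix A v
      = (twoHop A u v : ℝ) / ((nodeDegree A u : ℝ) * (nodeDegree A v : ℝ)) := by
  simp only [dotProduct, transitionMatrix, Matrix.of_apply, twoHop]
  push_cast
  rw [Finset.sum_div]
  exact Finset.sum_congr rfl fun w _ => div_mul_div_comm _ _ _ _

theorem transitionMatrix_dotProduct_self_pos {u : V} (hu : 0 < nodeDegree A u) :
    0 < transitionMatrix A u ⬝ᵥ transitionMatrix A u := by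
  obtain ⟨w, -, hw⟩ := Finset.exists_ne_zero_of_sum_ne_zero hu.ne'
  refine Finset.sum_pos' (fun w _ => mul_self_nonneg _) ⟨w, Finset.mem_univ w, ?_⟩
  have h1 : (0 : ℝ) < A u w := by exact_mod_cast Nat.pos_of_ne_zero hw
  have h2 : (0 : ℝ) < nodeDegree A u := by exact_mod_cast hu
  have h : 0 < transitionMatrix A u w := div_pos h1 h2
  positivity

theorem embedding_dotProduct {q : ℕ} (R : Matrix (Fin q) V ℝ) (u v : V) :
    embedding A R u ⬝ᵥ embedding A R v
      = ∑ i, (R i ⬝ᵥ transitionMatrix A u) * (R i ⬝ᵥ transitionMatrix A v) := by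
  have h : ∀ u i, embedding A R u i = R i ⬝ᵥ transitionMatrix A u := fun u i =>
    dotProduct_comm _ _
  simp only [dotProduct, h]

end Embedding

theorem concentration_bounds_of_sample_size {ε δ : ℝ} (hε : 0 < ε) (hε1 : ε < 1) (hδ : 0 < δ)
    (hδ1 : δ < 1) {n q : ℕ} (hn : 2 ≤ n)
    (hq : 4 * ((1 + ε) / ε ^ 2) * Real.log ((n : ℝ) * ((n : ℝ) - 1) / δ) ≤ (q : ℝ)) :
    6 ≤ q ∧ Real.log 2 ≤ q * ε ^ 2 / (4 * (1 + ε)) ∧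
      (n : ℝ) * (n + 1) / 2 * (2 / 3 * Real.exp (-(q * ε ^ 2 / (4 * (1 + ε))))) ≤ δ := by
  have hn' : (2 : ℝ) ≤ n := by exact_mod_cast hn
  have hN : 2 ≤ (n : ℝ) * (n - 1) := by nlinarith
  have hNδ : 2 ≤ (n : ℝ) * (n - 1) / δ := by
    rw [le_div_iff₀ hδ]; nlinarith
  have hlog : Real.log 2 ≤ Real.log ((n : ℝ) * (n - 1) / δ) :=
    Real.log_le_log (by norm_num) hNδ
  have hL : Real.log ((n : ℝ) * (n - 1) / δ) ≤ q * ε ^ 2 / (4 * (1 + ε)) := by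
    rw [le_div_iff₀ (by positivity)]
    have e : 4 * ((1 + ε) / ε ^ 2) * Real.log ((n : ℝ) * ((n : ℝ) - 1) / δ)
        = Real.log ((n : ℝ) * ((n : ℝ) - 1) / δ) * (4 * (1 + ε)) / ε ^ 2 := by ring
    rwa [e, div_le_iff₀ (by positivity)] at hq
  have hL2 := hlog.trans hL
  refine ⟨?_, hL2, ?_⟩
  · have h2 := Real.log_two_gt_d9
    rw [le_div_iff₀ (by positivity)] at hL2
    -- Since ε < 1, q ≥ 4 log 2 (1+ε)/ε² > 8 log 2 > 5, so q ≥ 6; then m = q - 2 ≥ 4.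
    have h5 : (5 : ℝ) < q := by
      by_contra! h
      have : q * ε ^ 2 ≤ 5 * ε ^ 2 := by gcongr
      nlinarith
    exact_mod_cast h5
  · have he : Real.exp (-(q * ε ^ 2 / (4 * (1 + ε)))) ≤ δ / ((n : ℝ) * (n - 1)) := by
      rw [← inv_div _ δ, ← Real.exp_log (by positivity : 0 < (n : ℝ) * (n - 1) / δ), ← Real.exp_neg]
      exact Real.exp_le_exp.2 (neg_le_neg hL)
    calc (n : ℝ) * (n + 1) / 2 * (2 / 3 * Real.exp (-(q * ε ^ 2 / (4 * (1 + ε)))))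
        = (n : ℝ) * (n + 1) / 3 * Real.exp (-(q * ε ^ 2 / (4 * (1 + ε)))) := by ring
      -- The comparison n(n+1)/3 ≤ n(n-1) is sharp at n = 2.
      _ ≤ (n : ℝ) * (n - 1) * (δ / ((n : ℝ) * (n - 1))) := by
          gcongr
          nlinarith
      _ = δ := mul_div_cancel₀ δ (by linarith)

theorem mainTheorem2 {V : Type*} [Fintype V] (A : Matrix V V ℕ)
    (hA : ∀ u, 0 < nodeDegree A u)
    {Ω : ℕ → Type*} [∀ q, MeasurableSpace (Ω q)]
    (P : ∀ q, Measure (Ω q)) [∀ q, IsProbabilityMeasure (P q)]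
    (R : ∀ q, Ω q → Matrix (Fin q) V ℝ)
    (hR : ∀ q, IsGaussianProjection (R q) (P q)) :
    (∀ u v : V,
      AsymptoticallyNormal P
        (fun q ω => embedding A (R q ω) u ⬝ᵥ embedding A (R q ω) v)
        ((twoHop A u v : ℝ) / ((nodeDegree A u : ℝ) * (nodeDegree A v : ℝ)))
        ((twoHop A u u : ℝ) * (twoHop A v v : ℝ)
            / ((nodeDegree A u : ℝ) ^ 2 * (nodeDegree A v : ℝ) ^ 2)
          + ((twoHop A u v : ℝ) / ((nodeDegree A u : ℝ) * (nodeDegree A v : ℝ))) ^ 2)) ∧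
    (2 ≤ Fintype.card V →
      ∀ (ε δ : ℝ), 0 < ε → ε < 1 → 0 < δ → δ < 1 →
      ∀ q : ℕ,
        4 * ((1 + ε) / ε ^ 2)
            * Real.log ((Fintype.card V : ℝ) * ((Fintype.card V : ℝ) - 1) / δ) ≤ (q : ℝ) →
        ENNReal.ofReal (1 - δ) ≤
          P q {ω | ∀ u v : V,
            |embedding A (R q ω) u ⬝ᵥ embedding A (R q ω) v
                - (twoHop A u v : ℝ) / ((nodeDegree A u : ℝ) * (nodeDegree A v : ℝ))|
              < ε * (√((twoHop A u u : ℝ) * (twoHop A v v : ℝ))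
                  / ((nodeDegree A u : ℝ) * (nodeDegree A v : ℝ)))}) := by
  have hpos := fun u => transitionMatrix_dotProduct_self_pos A (hA u)
  have hd : ∀ u, (0 : ℝ) < nodeDegree A u := fun u => by exact_mod_cast hA u
  constructor
  · intro u v
    have h := asymptoticallyNormal_sum_row_mul_row P R hR (hpos u) (hpos v)
    simp only [embedding_dotProduct, ← transitionMatrix_dotProduct]
    convert h using 2
    rw [transitionMatrix_dotProduct, transitionMatrix_dotProduct, div_mul_div_comm]
    ring
  · intro hn ε δ hε hε1 hδ hδ1 q hq
    obtain ⟨hq6, hL, hle⟩ := concentration_bounds_of_sample_size hε hε1 hδ hδ1 hn hq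
    set T := transitionMatrix A with hT
    let B : V → V → Set (Ω q) := fun u v => {ω | ε * √((T u ⬝ᵥ T u) * (T v ⬝ᵥ T v))
      ≤ |∑ i, (R q ω i ⬝ᵥ T u) * (R q ω i ⬝ᵥ T v) - T u ⬝ᵥ T v|}
    have hB := measure_iUnion_symmetric_le (P q) B
      (fun u v => by
        simp only [B, dotProduct_comm (T u) (T v), mul_comm (T u ⬝ᵥ T u),
          mul_comm (R q _ _ ⬝ᵥ T u)])
      (fun u v => (hR q).deviation_le hq6 (hpos u) (hpos v)
        (by rw [transitionMatrix_dotProduct]; positivity) hε hε1 hL)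
    have hB' := hB.trans (ENNReal.ofReal_le_ofReal hle)
    -- The space is covered by the good event and the union of bad ones, so subadditivity suffices
    -- and no measurability is needed.
    rw [ENNReal.ofReal_sub _ hδ.le, ENNReal.ofReal_one, tsub_le_iff_right, ← measure_univ (μ := P q)]
    refine (measure_mono fun ω _ => ?_).trans
      ((measure_union_le _ _).trans (add_le_add_right hB' _))
    rw [Set.mem_union, or_iff_not_imp_right]
    intro hω u v
    have huv : ω ∉ B u v := fun h => hω (Set.mem_iUnion₂.2 ⟨u, v, h⟩)
    have e : √((T u ⬝ᵥ T u) * (T v ⬝ᵥ T v)) = √((twoHop A u u : ℝ) * (twoHop A v v : ℝ))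
        / ((nodeDegree A u : ℝ) * (nodeDegree A v : ℝ)) := by
      rw [hT, transitionMatrix_dotProduct, transitionMatrix_dotProduct, div_mul_div_comm,
        Real.sqrt_div (by positivity), ← Real.sqrt_mul_self (mul_pos (hd u) (hd v)).le]
      congr 2
      ring
    rw [embedding_dotProduct, ← transitionMatrix_dotProduct, ← e]
    exact not_le.1 huv
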